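/- Let $G$ be a compact, second countable Hausdorff group (for example a compact Lie group or a finite group) with normalized Haar measure $\mu_G$. Let $(S_t)_{t\ge 0}$ be a strongly continuous Markov semigroup on the bounded measurable functions on $G$, $S_0=\mathrm{id}$, with a measurable right-invariant kernel, $S_t f(g)=\int_G k_t(g,h)f(h)\,d\mu_G(h)$, $k_t\ge 0$, $k_t(ga,ha)=k_t(g,h)$, for all $t>0$ (and also for $t=0$ if $G$ is finite), and write $k_t(g)=k_t(g,e)$. Let $g\mapsto u(g)$ be a continuous projective unitary representation of $G$ on a finite-dimensional Hilbert space $\mathcal H$ (that is, $u(gh)$ equals $u(g)u(h)$ up to a phase and $g\mapsto u(g)^*xu(g)$ is continuous for all $x$), and let $(T_t)_{t\ge0}$ be the transferred quantum Markov semigroup $$T_t(x)=\int_G k_t(g^{-1})\,u(g)^*x\,u(g)\,d\mu_G(g)\quad(t>0),\qquad T_0=\mathrm{id}.$$ Let $N_{fix}=\{x\in\mathcal B(\mathcal H): T_t(x)=x\ \forall t\ge0\}$, let $E_{fix}$ be the orthogonal projection of $\mathcal B(\mathcal H)$ onto $N_{fix}$ for the inner product $\operatorname{Tr}(x^*y)$,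 and let $\mathcal D(N_{fix})$ be the set of density matrices $\sigma$ with $E_{fix}(\sigma)=\sigma$. For density matrices $\rho,\sigma$ with $\ker\sigma\subseteq\ker\rho$ put, with logarithms and negative powers taken on supports, $$D_p(\rho\|\sigma)=\tfrac1{p-1}\log\operatorname{Tr}\big[(\sigma^{\frac{1-p}{2p}}\rho\,\sigma^{\frac{1-p}{2p}})^p\big]\ (1<p<\infty),\quad D(\rho\|\sigma)=\operatorname{Tr}\rho(\log\rho-\log\sigma),\quad D_\infty(\rho\|\sigma)=\log\|\sigma^{-1/2}\rho\,\sigma^{-1/2}\|_\infty ,$$ and let all of them be $+\infty$ if $\ker\sigma\not\subseteq\ker\rho$. Let $\epsilon>0$ be such that the set of $t\ge0$ for which $k_t$ exists and $\|k_t-1\|_{L_\infty(\mu_G)}\le\epsilon$ is non-empty, let $t(\epsilon)$ be the infimum of this set, and write $t=t(\epsilon)$. Then for every $\sigma\in\mathcal D(N_{fix})$ and every density matrix $\rho$ on $\mathcal H$: 1. for every $p\in(1,\infty)$, $$D_p(E_{fix}(\rho)\|\sigma)\le D_p(T_{t}(\rho)\|\sigma)\le D_p(E_{fix}(\rho)\|\sigma)+\tfrac{p}{p-1}\log\|k_{t}\|_{L_p(\mu_G)}\le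 D_p(E_{fix}(\rho)\|\sigma)+\log(1+\epsilon);$$ 2. (the case $p=1$) $k_t\log k_t$ is integrable and $$D(E_{fix}(\rho)\|\sigma)\le D(T_{t}(\rho)\|\sigma)\le D(E_{fix}(\rho)\|\sigma)+\int_G k_{t}\log k_{t}\,d\mu_G\le D(E_{fix}(\rho)\|\sigma)+\log(1+\epsilon);$$ 3. (the case $p=\infty$) $$D_\infty(E_{fix}(\rho)\|\sigma)\le D_\infty(T_{t}(\rho)\|\sigma)\le D_\infty(E_{fix}(\rho)\|\sigma)+\log\|k_{t}\|_{L_\infty(\mu_G)}\le D_\infty(E_{fix}(\rho)\|\sigma)+\log(1+\epsilon).$$ -/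

import Mathlib

open MeasureTheory Topology Filter
open scoped NNReal ENNReal Matrix ComplexOrder Matrix.Norms.L2Operator

noncomputable section

namespace TransferredQMS

variable {G : Type*} [Group G] [TopologicalSpace G] [MeasurableSpace G]
variable {n : Type*} [Fintype n] [DecidableEq n]

/-- The times at which the transition probabilities of a semigroup on `G` are asked to have a
density: all `t > 0`, and also `t = 0` when `G` is finite. (On an infinite compact group
`S₀ = id` has no density with respect to the Haar measure.) -/
def IsKernelTime (G : Type*) (t : ℝ≥0) : Prop := 0 < t ∨ Finite G

/-- The operator `S_t f (g) = ∫ K t g h * f h dμ(h)` for `t > 0`, and `S_0 = id`. -/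
def kernelOp (μ : Measure G) (K : ℝ≥0 → G → G → ℝ) (t : ℝ≥0) (f : G → ℝ) (g : G) : ℝ :=
  if t = 0 then f g else ∫ h, K t g h * f h ∂μ

/-- A (strongly continuous) right-invariant Markov semigroup `(S_t)` on the bounded measurable
functions of the compact group `G`, with kernel `k_t(g,h)` with respect to `μ`
(the normalized Haar measure in the applications). -/
structure MarkovSemigroup (μ : Measure G) where
  /-- the kernel `k_t(g,h)`; its values at `t = 0` are only meaningful for finite `G` -/
  K : ℝ≥0 → G → G → ℝ
  measurable : ∀ t, 0 < t → Measurable (Function.uncurry (K t))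
  nonneg : ∀ t, 0 < t → ∀ g h, 0 ≤ K t g h
  /-- `S_t 1 = 1` -/
  mass : ∀ t, 0 < t → ∀ g, ∫ h, K t g h ∂μ = 1
  right_invariant : ∀ t, 0 < t → ∀ g h a, K t (g * a) (h * a) = K t g h
  /-- `S_{s+t} = S_s S_t` on bounded measurable functions -/
  semigroup : ∀ s t, ∀ f : G → ℝ, Measurable f → (∃ C, ∀ g, |f g| ≤ C) →
    ∀ g, kernelOp μ K (s + t) f g = kernelOp μ K s (kernelOp μ K t f) g
  /-- strong continuity at `0` -/
  continuous : ∀ f : G → ℝ, Continuous f → ∀ g,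
    Tendsto (fun t => kernelOp μ K t f g) (𝓝[>] 0) (𝓝 (f g))
  /-- on a finite group, the kernel at time `0` represents `S_0 = id` -/
  zero : Finite G → ∀ (f : G → ℝ) g, ∫ h, K 0 g h * f h ∂μ = f g

/-- The convolution kernel `k_t(g) = k_t(g, e)`. -/
def MarkovSemigroup.k {μ : Measure G} (S : MarkovSemigroup μ) (t : ℝ≥0) (g : G) : ℝ := S.K t g 1

/-- The set of times at which `‖k_t - 1‖_∞ ≤ ε`. -/
def MarkovSemigroup.mixingTimes {μ : Measure G} (S : MarkovSemigroup μ) (ε : ℝ) : Set ℝ≥0 :=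
  {t | IsKernelTime G t ∧ eLpNorm (fun g => S.k t g - 1) ∞ μ ≤ ENNReal.ofReal ε}

/-- `t(ε) = inf {t ≥ 0 | ‖k_t - 1‖_∞ ≤ ε}` (meaningful when the set is non-empty). -/
def MarkovSemigroup.tEps {μ : Measure G} (S : MarkovSemigroup μ) (ε : ℝ) : ℝ≥0 :=
  sInf (S.mixingTimes ε)

/-- A (continuous, unitary) projective representation of `G` on `ℂⁿ`: unitaries `u(g)` that are
multiplicative up to phases, and that depend continuously on `g` up to phases, that is, the
conjugation `u(g)^* x u(g)` is continuous in `g`. -/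
structure ProjectiveRep (G : Type*) [Group G] [TopologicalSpace G]
    (n : Type*) [Fintype n] [DecidableEq n] where
  u : G → Matrix n n ℂ
  unitary : ∀ g, u g ∈ Matrix.unitaryGroup n ℂ
  mul : ∀ g h, ∃ c : ℂ, ‖c‖ = 1 ∧ u (g * h) = c • (u g * u h)
  continuous : ∀ x : Matrix n n ℂ, Continuous fun g => (u g)ᴴ * x * u g

/-- `T_t(x) = ∫ k_t(g⁻¹) u(g)^* x u(g) dμ(g)` for `t > 0`, and `T_0 = id`, as a function. -/
def transferredFun {μ : Measure G} (S : MarkovSemigroup μ) (U : ProjectiveRep G n)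
    (t : ℝ≥0) (x : Matrix n n ℂ) : Matrix n n ℂ :=
  if t = 0 then x else ∫ g, ((S.k t g⁻¹ : ℝ) : ℂ) • ((U.u g)ᴴ * x * U.u g) ∂μ

theorem MarkovSemigroup.integrable_k_inv {μ : Measure G} (S : MarkovSemigroup μ) {t : ℝ≥0} (ht : 0 < t) :
    Integrable (fun g => S.k t g⁻¹) μ := by
  have h1 : Integrable (fun h => S.K t 1 h) μ := by
    by_contra hc
    have := S.mass t ht 1
    rw [integral_undef hc] at this
    exact zero_ne_one this
  refine h1.congr (Eventually.of_forall fun h => ?_)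
  have := S.right_invariant t ht 1 h h⁻¹
  simpa [MarkovSemigroup.k] using this.symm

section linear

variable [IsTopologicalGroup G] [CompactSpace G] [SecondCountableTopology G] [BorelSpace G]
variable {μ : Measure G} [μ.IsHaarMeasure] [IsProbabilityMeasure μ]

theorem integrable_transferred (S : MarkovSemigroup μ) (U : ProjectiveRep G n) {t : ℝ≥0}
    (ht : 0 < t) (x : Matrix n n ℂ) :
    Integrable (fun g => ((S.k t g⁻¹ : ℝ) : ℂ) • ((U.u g)ᴴ * x * U.u g)) μ := by
  have hk : Integrable (fun g => ((S.k t g⁻¹ : ℝ) : ℂ)) μ := (S.integrable_k_inv ht).ofReal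
  obtain ⟨C, hC⟩ := isCompact_univ.exists_bound_of_continuousOn (U.continuous x).continuousOn
  exact hk.smul_bdd C (U.continuous x).aestronglyMeasurable
    (Eventually.of_forall fun g => hC g (Set.mem_univ g))

/-- The transferred quantum Markov semigroup `(T_t)` of the semigroup `S` and the projective
representation `U`, as linear maps on the `n × n` matrices. -/
def transferred (S : MarkovSemigroup μ) (U : ProjectiveRep G n) (t : ℝ≥0) :
    Matrix n n ℂ →ₗ[ℂ] Matrix n n ℂ where
  toFun := transferredFun S U t
  map_add' x y := by
    rcases eq_or_ne t 0 with rfl | ht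
    · simp [transferredFun]
    · have ht' : 0 < t := pos_iff_ne_zero.2 ht
      simp only [transferredFun, if_neg ht]
      rw [← integral_add (integrable_transferred S U ht' x) (integrable_transferred S U ht' y)]
      simp [mul_add, add_mul]
  map_smul' c x := by
    rcases eq_or_ne t 0 with rfl | ht
    · simp [transferredFun]
    · simp only [transferredFun, if_neg ht, RingHom.id_apply]
      rw [← integral_smul]
      refine integral_congr_ae (Eventually.of_forall fun g => ?_)
      simp [smul_comm c]

/-- The fixed points `N_fix = {x | T_t(x) = x for all t ≥ 0}`. -/
def Nfix (S : MarkovSemigroup μ) (U : ProjectiveRep G n) : Submodule ℂ (Matrix n n ℂ) where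
  carrier := {x | ∀ t, transferred S U t x = x}
  add_mem' hx hy t := by rw [map_add, hx t, hy t]
  zero_mem' t := map_zero _
  smul_mem' c x hx t := by rw [map_smul, hx t]

end linear

/-- Matrices as vectors of entries with the Euclidean (Hilbert–Schmidt) inner product. -/
def hsEquiv (n : Type*) [Fintype n] : Matrix n n ℂ ≃ₗ[ℂ] EuclideanSpace ℂ (n × n) :=
  (LinearEquiv.curry ℂ ℂ n n).symm ≪≫ₗ (WithLp.linearEquiv 2 ℂ (n × n → ℂ)).symm

theorem inner_hsEquiv {n : Type*} [Fintype n] (x y : Matrix n n ℂ) :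
    inner ℂ (hsEquiv n x) (hsEquiv n y) = (xᴴ * y).trace := by
  simp only [PiLp.inner_apply, hsEquiv, Matrix.trace, Matrix.diag, Matrix.mul_apply,
    Fintype.sum_prod_type]
  rw [Finset.sum_comm]
  refine Finset.sum_congr rfl fun i _ => Finset.sum_congr rfl fun j _ => ?_
  rw [Matrix.conjTranspose_apply, mul_comm]
  rfl

/-- The orthogonal projection onto a subspace of matrices for the Hilbert–Schmidt inner product
`⟨x, y⟩ = Tr (x^* y)`. -/
def hsProj {n : Type*} [Fintype n] (N : Submodule ℂ (Matrix n n ℂ)) : Matrix n n ℂ →ₗ[ℂ] Matrix n n ℂ :=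
  (hsEquiv n).symm.toLinearMap ∘ₗ
    (N.map (hsEquiv n).toLinearMap).starProjection.toLinearMap ∘ₗ (hsEquiv n).toLinearMap

theorem hsProj_mem {n : Type*} [Fintype n] (N : Submodule ℂ (Matrix n n ℂ)) (x : Matrix n n ℂ) : hsProj N x ∈ N := by
  obtain ⟨y, hy, hxy⟩ := Submodule.starProjection_apply_mem
    (N.map (hsEquiv n).toLinearMap) (hsEquiv n x)
  have : hsProj N x = y := by
    simp only [hsProj, LinearMap.comp_apply, LinearEquiv.coe_coe, ContinuousLinearMap.coe_coe]
    rw [← hxy]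
    simp
  rwa [this]

theorem hsProj_orthogonal {n : Type*} [Fintype n] (N : Submodule ℂ (Matrix n n ℂ)) (x y : Matrix n n ℂ) (hy : y ∈ N) :
    (yᴴ * (x - hsProj N x)).trace = 0 := by
  rw [← inner_hsEquiv, map_sub]
  have h := Submodule.sub_starProjection_mem_orthogonal
    (K := N.map (hsEquiv n).toLinearMap) (hsEquiv n x)
  have := (Submodule.mem_orthogonal _ _).1 h (hsEquiv n y) ⟨y, hy, rfl⟩
  simpa only [hsProj, LinearMap.comp_apply, LinearEquiv.coe_coe, ContinuousLinearMap.coe_coe,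
    LinearEquiv.apply_symm_apply] using this

/-- Density matrices. -/
def IsState (ρ : Matrix n n ℂ) : Prop := ρ.PosSemidef ∧ ρ.trace = 1

section fix

variable [IsTopologicalGroup G] [CompactSpace G] [SecondCountableTopology G] [BorelSpace G]
variable {μ : Measure G} [μ.IsHaarMeasure] [IsProbabilityMeasure μ]

/-- `E_fix`, the orthogonal projection onto `N_fix` for the Hilbert–Schmidt inner product. -/
def Efix (S : MarkovSemigroup μ) (U : ProjectiveRep G n) : Matrix n n ℂ →ₗ[ℂ] Matrix n n ℂ :=
  hsProj (Nfix S U)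

/-- `𝒟(N_fix)`: the density matrices `σ` with `E_fix(σ) = σ`. -/
def IsFixState (S : MarkovSemigroup μ) (U : ProjectiveRep G n) (σ : Matrix n n ℂ) : Prop :=
  IsState σ ∧ Efix S U σ = σ

end fix

/-- The real power `a ^ s` of a positive semidefinite matrix, with `0 ^ s = 0` for `s ≠ 0`
(so that negative powers are taken on the support). -/
def mpow (a : Matrix n n ℂ) (s : ℝ) : Matrix n n ℂ := cfc (fun x : ℝ => x ^ s) a

/-- The logarithm of a positive semidefinite matrix, taken on its support (`log 0 = 0`). -/
def mlog (a : Matrix n n ℂ) : Matrix n n ℂ := cfc Real.log a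

/-- `ker σ ⊆ ker ρ`. -/
def KerLE (σ ρ : Matrix n n ℂ) : Prop := ∀ v : n → ℂ, σ *ᵥ v = 0 → ρ *ᵥ v = 0

open Classical in
/-- The sandwiched Rényi divergence `D_p(ρ‖σ)` for `p ∈ (1, ∞)`. -/
def sandwichedRenyi (p : ℝ) (ρ σ : Matrix n n ℂ) : EReal :=
  if KerLE σ ρ then
    ((1 / (p - 1) * Real.log (mpow (mpow σ ((1 - p) / (2 * p)) * ρ *
      mpow σ ((1 - p) / (2 * p))) p).trace.re : ℝ) : EReal)
  else ⊤

open Classical in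
/-- `D_∞(ρ‖σ) = log ‖σ^{-1/2} ρ σ^{-1/2}‖_∞`, with the operator norm. -/
def maxRenyi (ρ σ : Matrix n n ℂ) : EReal :=
  if KerLE σ ρ then
    ((Real.log ‖mpow σ (-(1 / 2)) * ρ * mpow σ (-(1 / 2))‖ : ℝ) : EReal)
  else ⊤

open Classical in
/-- The quantum relative entropy `D(ρ‖σ) = Tr ρ (log ρ - log σ)`. -/
def relEntropy (ρ σ : Matrix n n ℂ) : EReal :=
  if KerLE σ ρ then (((ρ * (mlog ρ - mlog σ)).trace.re : ℝ) : EReal) else ⊤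

end TransferredQMS

end

/-!
Let `H` be the group of all `g` whose conjugation fixes `N_fix` pointwise. The random element with
density `k_t(g⁻¹)` lies in `H` almost surely, because a mixture of isometric images of `x` equals
`x` only if almost all of them do. Hence the closed group `H` has positive Haar measure, `N_fix` is
the fixed point algebra of `H`, `E_fix` is the average over `H`, and `T_t` is the average over `H`
against a density. The lower bounds follow from `E_fix T_t = E_fix` and data processing for `E_fix`.

For the upper bounds, powers of `σ ∈ N_fix` commute with the averages, which reduces everything to
`Tr (T_t X)^p ≤ ‖k_t‖_p^p Tr (E_fix X)^p` for `X ≥ 0`. Replacing `k_t` by the complex power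
`k_t^{pz}` gives an analytic family to which the three lines theorem applies. The case `p = 1`
follows by differentiating at `p = 1`, where both sides agree.

At the infimum `t(ε)` the bound `k_t ≤ 1 + ε` survives in the form `law ≤ (1 + ε) μ`: this passes to
weak limits by the portmanteau theorem, and `t ↦ law` is weakly right-continuous.
-/

noncomputable section

namespace TransferredQMS

open scoped MatrixOrder ProbabilityTheory

section Trace

variable {n : Type*} [Fintype n] {A B C : Matrix n n ℂ}

theorem trace_re_nonneg (hA : 0 ≤ A) : 0 ≤ A.trace.re :=
  (Complex.le_def.1 (Matrix.nonneg_iff_posSemidef.1 hA).trace_nonneg).1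

theorem trace_mul_re_nonneg (hA : 0 ≤ A) (hB : 0 ≤ B) : 0 ≤ (A * B).trace.re := by
  classical
  obtain ⟨Y, rfl⟩ := CStarAlgebra.nonneg_iff_eq_star_mul_self.1 hB
  rw [← Matrix.mul_assoc, Matrix.trace_mul_comm, ← Matrix.mul_assoc]
  exact trace_re_nonneg (star_right_conjugate_nonneg hA Y)

theorem trace_mul_re_mono (hA : 0 ≤ A) (h : B ≤ C) : (A * B).trace.re ≤ (A * C).trace.re := by
  simpa [Matrix.mul_sub] using trace_mul_re_nonneg hA (sub_nonneg.2 h)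

theorem norm_hsEquiv_sq (A : Matrix n n ℂ) : ‖hsEquiv n A‖ ^ 2 = (Aᴴ * A).trace.re := by
  rw [← inner_hsEquiv, inner_self_eq_norm_sq_to_K]
  norm_cast

variable [DecidableEq n]

theorem norm_trace_mul_mul_le {x L R : Matrix n n ℂ} (hC : Cᴴ * C ≤ 1) (hx : 0 ≤ x) :
    ‖(C * L * x * R).trace‖ ≤ ((L * x * Lᴴ).trace.re + (Rᴴ * x * R).trace.re) / 2 := by
  obtain ⟨y, hy⟩ := CStarAlgebra.nonneg_iff_eq_star_mul_self.1 hx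
  rw [Matrix.star_eq_conjTranspose] at hy
  set P := y * Lᴴ * Cᴴ
  set Q := y * R
  have hPQ : (C * L * x * R).trace = inner ℂ (hsEquiv n P) (hsEquiv n Q) := by
    rw [inner_hsEquiv]
    simp only [P, Q, hy, Matrix.conjTranspose_mul, Matrix.conjTranspose_conjTranspose,
      Matrix.mul_assoc]
  have hP : ‖hsEquiv n P‖ ^ 2 ≤ (L * x * Lᴴ).trace.re := by
    have hLx : 0 ≤ L * x * Lᴴ := star_right_conjugate_nonneg hx L
    calc ‖hsEquiv n P‖ ^ 2 = (C * (L * x * Lᴴ * Cᴴ)).trace.re := by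
          rw [norm_hsEquiv_sq]
          simp only [P, hy, Matrix.conjTranspose_mul, Matrix.conjTranspose_conjTranspose,
            Matrix.mul_assoc]
      _ = (L * x * Lᴴ * (Cᴴ * C)).trace.re := by rw [Matrix.trace_mul_comm, Matrix.mul_assoc]
      _ ≤ (L * x * Lᴴ * 1).trace.re := trace_mul_re_mono hLx hC
      _ = (L * x * Lᴴ).trace.re := by rw [Matrix.mul_one]
  have hQ : ‖hsEquiv n Q‖ ^ 2 = (Rᴴ * x * R).trace.re := by
    rw [norm_hsEquiv_sq]
    simp only [Q, hy, Matrix.conjTranspose_mul, Matrix.mul_assoc]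
  rw [hPQ]
  have hCS := norm_inner_le_norm (𝕜 := ℂ) (hsEquiv n P) (hsEquiv n Q)
  nlinarith [sq_nonneg (‖hsEquiv n P‖ - ‖hsEquiv n Q‖)]

theorem trace_cfc (hA : A.IsHermitian) (f : ℝ → ℝ) :
    (cfc f A).trace = ∑ i, (f (hA.eigenvalues i) : ℂ) := by
  rw [hA.cfc_eq, Matrix.IsHermitian.cfc, Unitary.conjStarAlgAut_apply, Matrix.trace_mul_comm,
    ← Matrix.mul_assoc, Unitary.coe_star_mul_self, Matrix.one_mul, Matrix.trace_diagonal]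
  rfl

/-- The witness `w` is the joint spectral distribution of `A` and `B`. -/
theorem exists_trace_cfc_mul_cfc_eq_sum (hA : A.IsHermitian) (hB : B.IsHermitian) :
    ∃ w : n → n → ℝ, (∀ i j, 0 ≤ w i j) ∧ ∀ f g : ℝ → ℝ, (cfc f A * cfc g B).trace.re =
      ∑ i, ∑ j, w i j * (f (hA.eigenvalues i) * g (hB.eigenvalues j)) := by
  set U := (hA.eigenvectorUnitary : Matrix n n ℂ)
  set V := (hB.eigenvectorUnitary : Matrix n n ℂ)
  refine ⟨fun i j => ‖(Uᴴ * V) i j‖ ^ 2, fun i j => sq_nonneg _, fun f g => ?_⟩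
  have htrace : (cfc f A * cfc g B).trace =
      (Matrix.diagonal (fun i => (f (hA.eigenvalues i) : ℂ)) * (Uᴴ * V) *
        (Matrix.diagonal (fun j => (g (hB.eigenvalues j) : ℂ)) * (Uᴴ * V)ᴴ)).trace := by
    rw [hA.cfc_eq, hB.cfc_eq, Matrix.IsHermitian.cfc, Matrix.IsHermitian.cfc,
      Unitary.conjStarAlgAut_apply, Unitary.conjStarAlgAut_apply, Matrix.mul_assoc,
      Matrix.mul_assoc, Matrix.trace_mul_comm, Matrix.conjTranspose_mul,
      Matrix.conjTranspose_conjTranspose]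
    simp only [Matrix.mul_assoc]
    rfl
  rw [htrace, Matrix.trace, Complex.re_sum]
  refine Finset.sum_congr rfl fun i _ => ?_
  rw [Matrix.diag_apply, Matrix.mul_apply, Complex.re_sum]
  refine Finset.sum_congr rfl fun j _ => ?_
  rw [Matrix.diagonal_mul, Matrix.diagonal_mul, Matrix.conjTranspose_apply, mul_mul_mul_comm,
    Complex.star_def, Complex.mul_conj']
  norm_cast
  ring

end Trace

section Power

variable {n : Type*} [Fintype n] [DecidableEq n] {A B : Matrix n n ℂ}

theorem continuousOn_spectrum (A : Matrix n n ℂ) (f : ℝ → ℝ) : ContinuousOn f (spectrum ℝ A) :=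
  A.finite_real_spectrum.continuousOn f

theorem mpow_nonneg (hA : 0 ≤ A) (s : ℝ) : 0 ≤ mpow A s :=
  cfc_nonneg fun _ hx => Real.rpow_nonneg (spectrum_nonneg_of_nonneg hA hx) s

theorem mpow_one (hA : 0 ≤ A) : mpow A 1 = A := by
  simp only [mpow, Real.rpow_one, cfc_id' ℝ A hA.isSelfAdjoint]

theorem mpow_mul_mpow (hA : 0 ≤ A) {s t : ℝ} (hst : s + t ≠ 0) :
    mpow A s * mpow A t = mpow A (s + t) := by
  rw [mpow, mpow, ← cfc_mul _ _ A (continuousOn_spectrum _ _) (continuousOn_spectrum _ _)]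
  exact cfc_congr fun x hx => (Real.rpow_add' (spectrum_nonneg_of_nonneg hA hx) hst).symm

theorem self_mul_mpow (hA : 0 ≤ A) {s : ℝ} (hs : s ≠ 0) : A * mpow A (s - 1) = mpow A s := by
  have h := mpow_mul_mpow hA (s := 1) (t := s - 1) (by simpa using hs)
  rwa [mpow_one hA, add_sub_cancel] at h

theorem trace_mpow_re (hA : A.IsHermitian) (s : ℝ) :
    (mpow A s).trace.re = ∑ i, hA.eigenvalues i ^ s := by
  rw [mpow, trace_cfc hA, ← Complex.ofReal_sum, Complex.ofReal_re]

theorem mul_rpow_sub_one_le {a b p : ℝ} (ha : 0 ≤ a) (hb : 0 ≤ b) (hp : 1 < p) :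
    p * (a * b ^ (p - 1)) ≤ a ^ p + (p - 1) * b ^ p := by
  have hYoung := Real.young_inequality_of_nonneg ha (Real.rpow_nonneg hb (p - 1))
    (Real.HolderConjugate.conjExponent hp)
  rw [← Real.rpow_mul hb, Real.conjExponent, mul_div_cancel₀ _ (by linarith : p - 1 ≠ 0)] at hYoung
  have hp0 : 0 < p := by linarith
  have := mul_le_mul_of_nonneg_left hYoung hp0.le
  field_simp at this
  linarith

theorem trace_mul_mpow_sub_one_le (hA : 0 ≤ A) (hB : 0 ≤ B) {p : ℝ} (hp : 1 < p) :
    p * (A * mpow B (p - 1)).trace.re ≤ (mpow A p).trace.re + (p - 1) * (mpow B p).trace.re := by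
  have hA' := Matrix.nonneg_iff_posSemidef.1 hA
  have hB' := Matrix.nonneg_iff_posSemidef.1 hB
  obtain ⟨w, hw, h⟩ := exists_trace_cfc_mul_cfc_eq_sum hA'.1 hB'.1
  have h_mul := h id (· ^ (p - 1))
  have h_left := h (· ^ p) (fun _ => 1)
  have h_right := h (fun _ => 1) (· ^ p)
  rw [cfc_id ℝ A hA.isSelfAdjoint] at h_mul
  rw [cfc_const_one ℝ B hB.isSelfAdjoint, mul_one] at h_left
  rw [cfc_const_one ℝ A hA.isSelfAdjoint, one_mul] at h_right
  rw [mpow, mpow, mpow, h_mul, h_left, h_right]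
  simp only [Finset.mul_sum, ← Finset.sum_add_distrib]
  refine Finset.sum_le_sum fun i _ => Finset.sum_le_sum fun j _ => ?_
  have := mul_le_mul_of_nonneg_left
    (mul_rpow_sub_one_le (hA'.eigenvalues_nonneg i) (hB'.eigenvalues_nonneg j) hp) (hw i j)
  simp only [id]
  linarith

theorem trace_mpow_mono (hA : 0 ≤ A) (hAB : A ≤ B) {p : ℝ} (hp : 1 < p) :
    (mpow A p).trace.re ≤ (mpow B p).trace.re := by
  have hYoung := trace_mul_mpow_sub_one_le (hA.trans hAB) hA hp
  have hmono := trace_mul_re_mono (mpow_nonneg hA (p - 1)) hAB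
  rw [Matrix.trace_mul_comm, self_mul_mpow hA (by linarith), Matrix.trace_mul_comm _ B] at hmono
  have := mul_le_mul_of_nonneg_left hmono (by linarith : 0 ≤ p)
  linarith

theorem tendsto_trace_mpow_add_smul_one (hA : 0 ≤ A) {p : ℝ} (hp : 0 ≤ p) :
    Tendsto (fun δ : ℝ => (mpow (A + δ • 1) p).trace.re) (𝓝 0) (𝓝 (mpow A p).trace.re) := by
  have hA' := (Matrix.nonneg_iff_posSemidef.1 hA).1
  have h (δ : ℝ) : (mpow (A + δ • 1) p).trace.re = ∑ i, (hA'.eigenvalues i + δ) ^ p := by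
    have hadd : A + δ • 1 = cfc (fun x : ℝ => x + δ) A := by
      rw [cfc_add_const δ (fun x => x) A, cfc_id' ℝ A, Algebra.algebraMap_eq_smul_one]
    rw [hadd, mpow, ← cfc_comp' (fun x : ℝ => x ^ p) (fun x => x + δ) A
      ((A.finite_real_spectrum.image _).continuousOn _), trace_cfc hA', ← Complex.ofReal_sum,
      Complex.ofReal_re]
  simp only [h]
  rw [trace_mpow_re hA']
  refine tendsto_finsetSum _ fun i _ => ?_
  have : ContinuousAt (fun δ : ℝ => (hA'.eigenvalues i + δ) ^ p) 0 :=
    ContinuousAt.rpow_const (by fun_prop) (Or.inr hp)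
  simpa using this.tendsto

end Power

section EntireBounded

variable {E F : Type*} [NormedAddCommGroup E] [NormedSpace ℂ E] [NormedAddCommGroup F]
  [NormedSpace ℂ F]

/-- Entire functions that are bounded on the strip `0 ≤ Re z ≤ 1`, to which the three lines theorem
is applied. -/
structure IsEntireBounded (f : ℂ → E) : Prop where
  differentiable : Differentiable ℂ f
  bounded : ∃ C, ∀ z : ℂ, z.re ∈ Set.Icc 0 1 → ‖f z‖ ≤ C

namespace IsEntireBounded

theorem mul {R : Type*} [NormedRing R] [NormedAlgebra ℂ R] {f g : ℂ → R}
    (hf : IsEntireBounded f) (hg : IsEntireBounded g) : IsEntireBounded fun z => f z * g z := by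
  obtain ⟨C, hC⟩ := hf.bounded
  obtain ⟨D, hD⟩ := hg.bounded
  exact ⟨hf.differentiable.mul hg.differentiable, C * D, fun z hz =>
    norm_mul_le_of_le (hC z hz) (hD z hz)⟩

theorem clm_comp {f : ℂ → E} (hf : IsEntireBounded f) (T : E →L[ℂ] F) :
    IsEntireBounded fun z => T (f z) := by
  obtain ⟨C, hC⟩ := hf.bounded
  exact ⟨T.differentiable.comp hf.differentiable, ‖T‖ * C, fun z hz => T.le_opNorm_of_le (hC z hz)⟩

theorem of_norm_le_norm_re {f : ℂ → E} (hf : Differentiable ℂ f) (h : ∀ z, ‖f z‖ ≤ ‖f z.re‖) :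
    IsEntireBounded f := by
  obtain ⟨C, hC⟩ := (isCompact_Icc (a := (0 : ℝ)) (b := 1)).exists_bound_of_continuousOn
    (hf.continuous.comp Complex.continuous_ofReal).continuousOn
  exact ⟨hf, C, fun z hz => (h z).trans (hC z.re hz)⟩

theorem norm_le_interp {f : ℂ → E} (hf : IsEntireBounded f) {a b θ : ℝ} (hθ : θ ∈ Set.Icc 0 1)
    (ha : ∀ z : ℂ, z.re = 0 → ‖f z‖ ≤ a) (hb : ∀ z : ℂ, z.re = 1 → ‖f z‖ ≤ b) :
    ‖f θ‖ ≤ a ^ (1 - θ) * b ^ θ := by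
  obtain ⟨C, hC⟩ := hf.bounded
  have hbdd : BddAbove (norm ∘ f '' Complex.HadamardThreeLines.verticalClosedStrip 0 1) :=
    ⟨C, Set.forall_mem_image.2 fun z hz => hC z hz⟩
  simpa using Complex.HadamardThreeLines.norm_le_interp_of_mem_verticalClosedStrip' zero_lt_one
    (z := θ) (by simpa [Complex.HadamardThreeLines.verticalClosedStrip] using hθ)
    hf.differentiable.diffContOnCl hbdd ha hb

end IsEntireBounded

end EntireBounded

section ComplexPower

variable {n : Type*} [Fintype n] [DecidableEq n] {A : Matrix n n ℂ}

/-- The complex power `A ^ z = exp (z log A)` of a positive definite matrix. -/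
def cpow (A : Matrix n n ℂ) (z : ℂ) : Matrix n n ℂ := NormedSpace.exp (z • mlog A)

theorem cpow_zero (A : Matrix n n ℂ) : cpow A 0 = 1 := by simp [cpow]

theorem cpow_add (A : Matrix n n ℂ) (z w : ℂ) : cpow A (z + w) = cpow A z * cpow A w := by
  rw [cpow, add_smul]
  exact Matrix.exp_add_of_commute _ _ (((Commute.refl _).smul_left z).smul_right w)

theorem conjTranspose_cpow (A : Matrix n n ℂ) (z : ℂ) : (cpow A z)ᴴ = cpow A (star z) := by
  have hlog : (mlog A)ᴴ = mlog A := (cfc_predicate Real.log A : IsSelfAdjoint _)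
  rw [cpow, ← Matrix.exp_conjTranspose, Matrix.conjTranspose_smul, hlog, cpow]

theorem cpow_ofReal (hA : A.PosDef) (s : ℝ) : cpow A s = mpow A s := by
  have hspec : ∀ x ∈ spectrum ℝ A, 0 < x :=
    fun _ => (Matrix.isStrictlyPositive_iff_posDef.2 hA).spectrum_pos
  have hlog : (s : ℂ) • mlog A = cfc (fun x => s * Real.log x) A := by
    rw [cfc_const_mul s _ A (continuousOn_spectrum A _), mlog, Complex.coe_smul]
  rw [cpow, hlog, ← CFC.real_exp_eq_normedSpace_exp (cfc_predicate _ A), ← cfc_comp' Real.exp _ A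
    Real.continuous_exp.continuousOn (continuousOn_spectrum A _) hA.1.isSelfAdjoint, mpow]
  exact cfc_congr fun x hx => by rw [Real.rpow_def_of_pos (hspec x hx), mul_comm]

theorem conjTranspose_cpow_mul_self {z : ℂ} (hz : z.re = 0) : (cpow A z)ᴴ * cpow A z = 1 := by
  have : star z + z = 0 := by
    rw [Complex.star_def, add_comm, Complex.add_conj, hz, mul_zero, Complex.ofReal_zero]
  rw [conjTranspose_cpow, ← cpow_add, this, cpow_zero]

theorem norm_cpow (A : Matrix n n ℂ) (z : ℂ) : ‖cpow A z‖ = ‖cpow A z.re‖ := by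
  have hU : cpow A (z.im * Complex.I) ∈ unitary (Matrix n n ℂ) :=
    Matrix.mem_unitaryGroup_iff'.2 (conjTranspose_cpow_mul_self (by simp))
  conv_lhs => rw [← Complex.re_add_im z, cpow_add, CStarRing.norm_mul_mem_unitary _ hU]

theorem differentiable_cpow (A : Matrix n n ℂ) : Differentiable ℂ (cpow A) :=
  fun z => (hasDerivAt_exp_smul_const (mlog A) z).differentiableAt

theorem isEntireBounded_cpow_affine (A : Matrix n n ℂ) (a b : ℝ) :
    IsEntireBounded fun z => cpow A (a * z + b) := by
  refine .of_norm_le_norm_re ((differentiable_cpow A).comp (by fun_prop)) fun z => ?_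
  rw [norm_cpow]
  simp

end ComplexPower

section LaplaceTransform

theorem norm_cexp_mul_ofReal_le {z : ℂ} {r t Λ : ℝ} (hz : |z.re| ≤ r) (ht : |t| ≤ Λ) :
    ‖Complex.exp (z * t)‖ ≤ Real.exp (r * Λ) := by
  rw [Complex.norm_exp, Complex.re_mul_ofReal, Real.exp_le_exp]
  exact (le_abs_self _).trans ((abs_mul _ _).trans_le
    (mul_le_mul hz ht (abs_nonneg _) ((abs_nonneg _).trans hz)))

variable {Ω E : Type*} [MeasurableSpace Ω] {ν : Measure Ω} [NormedAddCommGroup E]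
  [NormedSpace ℂ E] {ℓ : Ω → ℝ} {Λ : ℝ} {x : Ω → E}

theorem integrable_cexp_smul (hℓm : Measurable ℓ) (hℓ : ∀ ω, |ℓ ω| ≤ Λ) (hx : Integrable x ν)
    (z : ℂ) : Integrable (fun ω => Complex.exp (z * ℓ ω) • x ω) ν :=
  hx.bdd_smul _ (by fun_prop) (.of_forall fun ω => norm_cexp_mul_ofReal_le le_rfl (hℓ ω))

theorem differentiable_integral_cexp_smul (hℓm : Measurable ℓ) (hℓ : ∀ ω, |ℓ ω| ≤ Λ)
    (hx : Integrable x ν) :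
    Differentiable ℂ fun z : ℂ => ∫ ω, Complex.exp (z * ℓ ω) • x ω ∂ν := by
  intro z₀
  have hbound (ω : Ω) (z : ℂ) (hz : z ∈ Metric.ball z₀ 1) :
      ‖(Complex.exp (z * ℓ ω) * ℓ ω) • x ω‖ ≤ Real.exp ((‖z₀‖ + 1) * Λ) * Λ * ‖x ω‖ := by
    have hz' : |z.re| ≤ ‖z₀‖ + 1 := (Complex.abs_re_le_norm z).trans
      (norm_le_norm_add_const_of_dist_le (Metric.mem_ball.1 hz).le)
    rw [norm_smul, norm_mul, Complex.norm_real]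
    gcongr
    exacts [norm_cexp_mul_ofReal_le hz' (hℓ ω), hℓ ω]
  refine (hasDerivAt_integral_of_dominated_loc_of_deriv_le (Metric.ball_mem_nhds z₀ one_pos)
    (.of_forall fun z => (integrable_cexp_smul hℓm hℓ hx z).aestronglyMeasurable)
    (integrable_cexp_smul hℓm hℓ hx z₀) ?_ (.of_forall hbound) (hx.norm.const_mul _)
    (.of_forall fun ω z _ => ?_)).2.differentiableAt
  · exact AEStronglyMeasurable.smul (by fun_prop) hx.aestronglyMeasurable
  · simpa using (((hasDerivAt_id z).mul_const (ℓ ω : ℂ)).cexp).smul_const (x ω)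

theorem isEntireBounded_integral_cexp_smul (hℓm : Measurable ℓ) (hℓ : ∀ ω, |ℓ ω| ≤ Λ)
    (hx : Integrable x ν) (p : ℝ) :
    IsEntireBounded fun z : ℂ => ∫ ω, Complex.exp (p * z * ℓ ω) • x ω ∂ν where
  differentiable := (differentiable_integral_cexp_smul hℓm hℓ hx).comp (by fun_prop)
  bounded := by
    refine ⟨∫ ω, Real.exp (|p| * Λ) * ‖x ω‖ ∂ν, fun z hz =>
      norm_integral_le_of_norm_le (hx.norm.const_mul _) (.of_forall fun ω => ?_)⟩
    rw [norm_smul]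
    gcongr
    refine norm_cexp_mul_ofReal_le ?_ (hℓ ω)
    rw [Complex.re_ofReal_mul, abs_mul, abs_of_nonneg hz.1]
    exact mul_le_of_le_one_right (abs_nonneg p) hz.2

end LaplaceTransform

section Interpolation

theorem le_of_le_rpow_mul_rpow {a b θ : ℝ} (hb : 0 ≤ b) (hθ : 0 < θ)
    (h : a ≤ a ^ (1 - θ) * b ^ θ) : a ≤ b := by
  by_contra! hba
  have ha' : 0 < a := hb.trans_lt hba
  have hlt : a ^ (1 - θ) * b ^ θ < a ^ (1 - θ) * a ^ θ := by gcongr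
  rw [← Real.rpow_add ha', sub_add_cancel, Real.rpow_one] at hlt
  exact hlt.not_ge h

variable {Ω : Type*} [MeasurableSpace Ω] {ν : Measure Ω}
variable {n : Type*} [Fintype n] [DecidableEq n]

/-- The functional `X ↦ Tr (L X R)`. -/
def traceMulMul (L R : Matrix n n ℂ) : Matrix n n ℂ →L[ℂ] ℂ :=
  (Matrix.traceLinearMap n ℂ ℂ ∘ₗ LinearMap.mulLeftRight ℂ (L, R)).toContinuousLinearMap

theorem traceMulMul_apply (L R X : Matrix n n ℂ) : traceMulMul L R X = (L * X * R).trace := rfl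

theorem trace_mul_integral_mul {f : Ω → Matrix n n ℂ} (hf : Integrable f ν)
    (L R : Matrix n n ℂ) : (L * (∫ ω, f ω ∂ν) * R).trace = ∫ ω, (L * f ω * R).trace ∂ν :=
  ((traceMulMul L R).integral_comp_comm hf).symm

theorem integrable_trace_mul_mul_re {f : Ω → Matrix n n ℂ} (hf : Integrable f ν)
    (L R : Matrix n n ℂ) : Integrable (fun ω => (L * f ω * R).trace.re) ν :=
  ((traceMulMul L R).integrable_comp hf).re

theorem trace_mul_integral_mul_re {f : Ω → Matrix n n ℂ} (hf : Integrable f ν)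
    (L R : Matrix n n ℂ) : (L * (∫ ω, f ω ∂ν) * R).trace.re = ∫ ω, (L * f ω * R).trace.re ∂ν := by
  rw [trace_mul_integral_mul hf]
  exact (integral_re ((traceMulMul L R).integrable_comp hf)).symm

variable {x : Ω → Matrix n n ℂ} (hx : ∀ ω, 0 ≤ x ω)

include hx in
theorem norm_trace_mul_integral_smul_mul_le {φ : Ω → ℂ} (hφ : Integrable (fun ω => φ ω • x ω) ν)
    {d : Ω → ℝ} (hd : Integrable (fun ω => d ω • x ω) ν) (hφd : ∀ ω, ‖φ ω‖ ≤ d ω)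
    {C : Matrix n n ℂ} (hC : Cᴴ * C ≤ 1) (L R : Matrix n n ℂ) :
    ‖(C * L * (∫ ω, φ ω • x ω ∂ν) * R).trace‖ ≤
      ((L * (∫ ω, d ω • x ω ∂ν) * Lᴴ).trace.re + (Rᴴ * (∫ ω, d ω • x ω ∂ν) * R).trace.re) / 2 := by
  have hL := integrable_trace_mul_mul_re hd L Lᴴ
  have hR := integrable_trace_mul_mul_re hd Rᴴ R
  rw [trace_mul_integral_mul hφ, trace_mul_integral_mul_re hd, trace_mul_integral_mul_re hd,
    ← integral_add hL hR, ← integral_div]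
  refine norm_integral_le_of_norm_le ((hL.add hR).div_const 2) (.of_forall fun ω => ?_)
  have h := norm_trace_mul_mul_le hC (hx ω) (L := L) (R := R)
  simp only [Matrix.mul_smul, Matrix.smul_mul, Matrix.trace_smul, Complex.smul_re,
    smul_eq_mul, ← mul_add, mul_div_assoc, norm_mul]
  exact mul_le_mul (hφd ω) h (norm_nonneg _) ((norm_nonneg _).trans (hφd ω))

/-- At `z = 1 / p` this is `Tr Z ^ p` if `Z = ∫ exp (ℓ) x`, and on the two edges of the strip
`0 ≤ Re z ≤ 1` it is controlled by `∫ x` and by `∫ exp (p ℓ) x`, respectively. -/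
def traceInterpolant (ν : Measure Ω) (x : Ω → Matrix n n ℂ) (ℓ : Ω → ℝ) (B Z : Matrix n n ℂ)
    (p : ℝ) (z : ℂ) : ℂ :=
  (cpow Z (p * (1 - z)) * cpow B ((p * z - 1) / 2) *
    (∫ ω, Complex.exp (p * z * ℓ ω) • x ω ∂ν) * cpow B ((p * z - 1) / 2)).trace

theorem trace_cpow_mul_mul_cpow {B : Matrix n n ℂ} (hB : B.PosDef) (X : Matrix n n ℂ) {w : ℂ}
    {s : ℝ} (hw : w.re = s / 2) :
    (cpow B w * X * (cpow B w)ᴴ).trace = (mpow B s * X).trace := by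
  have hws : star w + w = s := by
    rw [Complex.star_def, add_comm, Complex.add_conj, hw, mul_div_cancel₀ _ two_ne_zero]
  rw [conjTranspose_cpow, Matrix.trace_mul_comm, ← Matrix.mul_assoc, ← cpow_add, hws,
    cpow_ofReal hB]

theorem cpow_mul_mul_conjTranspose_cpow_le_one {B X : Matrix n n ℂ} (hB : B.PosDef) (hX : X ≤ B)
    {w : ℂ} (hw : w.re = -1 / 2) : cpow B w * X * (cpow B w)ᴴ ≤ 1 := by
  have hws : w + 1 + star w = 0 := by
    have := Complex.add_conj w
    rw [hw] at this
    rw [Complex.star_def, add_right_comm, this]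
    norm_num
  refine (star_right_conjugate_le_conjugate hX (cpow B w)).trans_eq ?_
  have hB1 : cpow B 1 = B := by
    have := cpow_ofReal hB 1
    rwa [mpow_one (Matrix.nonneg_iff_posSemidef.2 hB.posSemidef), Complex.ofReal_one] at this
  nth_rewrite 2 [← hB1]
  rw [Matrix.star_eq_conjTranspose, conjTranspose_cpow, ← cpow_add, ← cpow_add, hws, cpow_zero]

variable {ℓ : Ω → ℝ} {Λ p : ℝ} {B Z : Matrix n n ℂ}

theorem traceInterpolant_one_div (hp : 1 < p) (hZ : Z.PosDef)
    (hZx : ∫ ω, Real.exp (ℓ ω) • x ω ∂ν = Z) :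
    traceInterpolant ν x ℓ B Z p (1 / p : ℝ) = (mpow Z p).trace := by
  have hp0 : (p : ℂ) ≠ 0 := Complex.ofReal_ne_zero.2 (by linarith)
  have h_half : ((p : ℂ) * (1 / p : ℝ) - 1) / 2 = 0 := by
    push_cast
    field_simp
    simp
  have h_exp : (p : ℂ) * (1 - (1 / p : ℝ)) = (p - 1 : ℝ) := by
    push_cast
    field_simp
  have h_int : ∫ ω, Complex.exp (p * (1 / p : ℝ) * ℓ ω) • x ω ∂ν = Z := by
    rw [← hZx]
    refine integral_congr_ae (.of_forall fun ω => ?_)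
    simp [hp0, ← Complex.ofReal_exp]
  rw [traceInterpolant, h_half, h_exp, h_int, cpow_zero, Matrix.mul_one, Matrix.mul_one,
    cpow_ofReal hZ, Matrix.trace_mul_comm,
    self_mul_mpow (Matrix.nonneg_iff_posSemidef.2 hZ.posSemidef) (by linarith)]

variable (hxi : Integrable x ν) (hℓm : Measurable ℓ) (hℓ : ∀ ω, |ℓ ω| ≤ Λ)

include hxi hℓm hℓ

theorem isEntireBounded_traceInterpolant :
    IsEntireBounded (traceInterpolant ν x ℓ B Z p) := by
  have hZ := isEntireBounded_cpow_affine Z (-p) p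
  have hB := isEntireBounded_cpow_affine B (p / 2) (-1 / 2)
  have hx := isEntireBounded_integral_cexp_smul hℓm hℓ hxi p
  have h_eq : traceInterpolant ν x ℓ B Z p = fun z => traceMulMul 1 1
      (cpow Z ((-p : ℝ) * z + p) * cpow B ((p / 2 : ℝ) * z + (-1 / 2 : ℝ)) *
        (∫ ω, Complex.exp (p * z * ℓ ω) • x ω ∂ν) * cpow B ((p / 2 : ℝ) * z + (-1 / 2 : ℝ))) := by
    ext z
    have hZz : ((-p : ℝ) : ℂ) * z + p = p * (1 - z) := by push_cast; ring
    have hBz : ((p / 2 : ℝ) : ℂ) * z + (-1 / 2 : ℝ) = (p * z - 1) / 2 := by push_cast; ring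
    rw [traceMulMul_apply, Matrix.one_mul, Matrix.mul_one, hZz, hBz, traceInterpolant]
  rw [h_eq]
  exact (((hZ.mul hB).mul hx).mul hB).clm_comp (traceMulMul 1 1)

include hx

theorem norm_traceInterpolant_le_of_re_eq_zero (hZ : Z.PosDef) (hB : B.PosDef)
    (hxB : ∫ ω, x ω ∂ν ≤ B) {z : ℂ} (hz : z.re = 0) :
    ‖traceInterpolant ν x ℓ B Z p z‖ ≤ (mpow Z p).trace.re := by
  set w : ℂ := (p * z - 1) / 2
  set H := cpow Z (p / 2 : ℝ)
  have hw : w.re = -1 / 2 := by simp [w, hz]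
  have hH : Hᴴ = H := by rw [conjTranspose_cpow, Complex.star_def, Complex.conj_ofReal]
  have hHH : H * H = mpow Z p := by
    rw [← cpow_add, ← Complex.ofReal_add, add_halves, cpow_ofReal hZ]
  have hC : (cpow Z (-(p * z)))ᴴ * cpow Z (-(p * z)) ≤ 1 :=
    (conjTranspose_cpow_mul_self (by simp [hz])).le
  have hsplit : cpow Z (p * (1 - z)) = H * cpow Z (-(p * z)) * H := by
    rw [← cpow_add, ← cpow_add]
    congr 1
    push_cast
    ring
  have hφ (ω : Ω) : ‖Complex.exp (p * z * ℓ ω)‖ ≤ 1 := by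
    simp [Complex.norm_exp, hz]
  have hle := norm_trace_mul_integral_smul_mul_le hx (integrable_cexp_smul hℓm hℓ hxi _)
    (by simpa using hxi) hφ hC (H * cpow B w) (cpow B w * H)
  simp only [one_smul] at hle
  have hbound {v : ℂ} (hv : v.re = -1 / 2) :
      (H * (cpow B v * (∫ ω, x ω ∂ν) * (cpow B v)ᴴ) * H).trace.re ≤ (mpow Z p).trace.re := by
    rw [Matrix.mul_assoc, Matrix.trace_mul_comm, Matrix.mul_assoc, Matrix.trace_mul_comm, hHH]
    simpa using trace_mul_re_mono (mpow_nonneg (Matrix.nonneg_iff_posSemidef.2 hZ.posSemidef) p)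
      (cpow_mul_mul_conjTranspose_cpow_le_one hB hxB hv)
  have hleft := hbound hw
  have hright := hbound (v := star w) (by simpa using hw)
  rw [conjTranspose_cpow, star_star, ← conjTranspose_cpow] at hright
  simp only [Matrix.conjTranspose_mul, hH, Matrix.mul_assoc] at hle hleft hright
  simp only [traceInterpolant, hsplit, Matrix.mul_assoc]
  rw [Matrix.trace_mul_comm]
  simp only [Matrix.mul_assoc]
  linarith

theorem norm_traceInterpolant_le_of_re_eq_one (hB : B.PosDef) {z : ℂ} (hz : z.re = 1) :
    ‖traceInterpolant ν x ℓ B Z p z‖ ≤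
      (mpow B (p - 1) * ∫ ω, Real.exp (p * ℓ ω) • x ω ∂ν).trace.re := by
  set w : ℂ := (p * z - 1) / 2
  have hw : w.re = (p - 1) / 2 := by simp [w, hz]
  have hC : (cpow Z (p * (1 - z)))ᴴ * cpow Z (p * (1 - z)) ≤ 1 :=
    (conjTranspose_cpow_mul_self (by simp [hz])).le
  have hφ (ω : Ω) : ‖Complex.exp (p * z * ℓ ω)‖ ≤ Real.exp (p * ℓ ω) := by
    simp [Complex.norm_exp, hz]
  have hd : Integrable (fun ω => Real.exp (p * ℓ ω) • x ω) ν :=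
    (integrable_cexp_smul hℓm hℓ hxi p).congr (.of_forall fun ω => by
      simp [← Complex.ofReal_mul, ← Complex.ofReal_exp])
  have hle := norm_trace_mul_integral_smul_mul_le hx (integrable_cexp_smul hℓm hℓ hxi _) hd hφ hC
    (cpow B w) (cpow B w)
  have hstar : (cpow B w)ᴴ * (∫ ω, Real.exp (p * ℓ ω) • x ω ∂ν) * cpow B w =
      cpow B (star w) * (∫ ω, Real.exp (p * ℓ ω) • x ω ∂ν) * (cpow B (star w))ᴴ := by
    rw [conjTranspose_cpow, conjTranspose_cpow, star_star]
  rw [hstar, trace_cpow_mul_mul_cpow hB _ hw, trace_cpow_mul_mul_cpow hB _ (by simpa using hw),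
    add_self_div_two] at hle
  exact hle

omit hxi hℓm hℓ in
theorem trace_mpow_integral_smul_le (hxi : Integrable x ν) {c : Ω → ℝ} (hcm : Measurable c)
    {δ M : ℝ} (hδ : 0 < δ) (hc : ∀ ω, c ω ∈ Set.Icc δ M) (hp : 1 < p) (hB : B.PosDef)
    (hxB : ∫ ω, x ω ∂ν ≤ B) (hZ : (∫ ω, c ω • x ω ∂ν).PosDef) :
    (mpow (∫ ω, c ω • x ω ∂ν) p).trace.re ≤
      (mpow B (p - 1) * ∫ ω, c ω ^ p • x ω ∂ν).trace.re := by
  have hc0 (ω : Ω) : 0 < c ω := hδ.trans_le (hc ω).1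
  have hℓm : Measurable fun ω => Real.log (c ω) := Real.measurable_log.comp hcm
  have hℓ (ω : Ω) : |Real.log (c ω)| ≤ max |Real.log δ| |Real.log M| :=
    abs_le_max_abs_abs (Real.log_le_log hδ (hc ω).1) (Real.log_le_log (hc0 ω) (hc ω).2)
  have hexp (s : ℝ) (ω : Ω) : Real.exp (s * Real.log (c ω)) = c ω ^ s := by
    rw [Real.rpow_def_of_pos (hc0 ω), mul_comm]
  set Z := ∫ ω, c ω • x ω ∂ν with hZdef
  have hB0 := Matrix.nonneg_iff_posSemidef.2 hB.posSemidef
  have hright : 0 ≤ (mpow B (p - 1) * ∫ ω, c ω ^ p • x ω ∂ν).trace.re :=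
    trace_mul_re_nonneg (mpow_nonneg hB0 _)
      (integral_nonneg fun ω => smul_nonneg (Real.rpow_nonneg (hc0 ω).le p) (hx ω))
  have hinterp := (isEntireBounded_traceInterpolant (B := B) (Z := Z) (p := p) hxi hℓm
    hℓ).norm_le_interp (θ := 1 / p) ⟨by positivity, (div_le_one₀ (by linarith)).2 hp.le⟩
    (fun z hz => norm_traceInterpolant_le_of_re_eq_zero hx hxi hℓm hℓ hZ hB hxB hz)
    (fun z hz => norm_traceInterpolant_le_of_re_eq_one hx hxi hℓm hℓ hB hz)
  rw [traceInterpolant_one_div hp hZ (by simp only [Real.exp_log (hc0 _), hZdef])] at hinterp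
  simp only [hexp] at hinterp
  exact le_of_le_rpow_mul_rpow hright (by positivity)
    (((le_abs_self _).trans (Complex.abs_re_le_norm _)).trans hinterp)

end Interpolation

section Action

variable {G : Type*} [Group G] [TopologicalSpace G] {n : Type*} [Fintype n] [DecidableEq n]

/-- The conjugation `x ↦ u(g)^* x u(g)`; since the phases cancel, it is a right action of `G` by
`*`-automorphisms. -/
def ProjectiveRep.act (U : ProjectiveRep G n) (g : G) : Matrix n n ℂ ≃⋆ₐ[ℂ] Matrix n n ℂ :=
  Unitary.conjStarAlgAut ℂ _ (star ⟨U.u g, U.unitary g⟩)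

namespace ProjectiveRep

variable (U : ProjectiveRep G n) (g h : G) (x : Matrix n n ℂ)

theorem act_apply : U.act g x = (U.u g)ᴴ * x * U.u g := Unitary.conjStarAlgAut_star_apply _ x

theorem continuous_act : Continuous fun g => U.act g x := by
  simpa only [act_apply] using U.continuous x

theorem act_mul : U.act (g * h) x = U.act h (U.act g x) := by
  obtain ⟨c, hc, hu⟩ := U.mul g h
  have hphase : c * star c = 1 := by simp [Complex.mul_conj', hc]
  simp only [act_apply, hu, Matrix.conjTranspose_smul, Matrix.conjTranspose_mul, Matrix.smul_mul,
    Matrix.mul_smul, smul_smul, hphase, one_smul, Matrix.mul_assoc]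

theorem act_one : U.act 1 x = x :=
  EquivLike.injective (U.act 1) (by rw [← act_mul, mul_one])

theorem trace_act : (U.act g x).trace = x.trace := by
  rw [act_apply, Matrix.trace_mul_comm, ← Matrix.mul_assoc,
    ← Matrix.star_eq_conjTranspose, Matrix.mem_unitaryGroup_iff.1 (U.unitary g), Matrix.one_mul]

theorem norm_act : ‖U.act g x‖ = ‖x‖ := StarAlgEquiv.norm_map _ x

theorem norm_hsEquiv_act : ‖hsEquiv n (U.act g x)‖ = ‖hsEquiv n x‖ := by
  rw [← sq_eq_sq₀ (norm_nonneg _) (norm_nonneg _), norm_hsEquiv_sq, norm_hsEquiv_sq,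
    ← Matrix.star_eq_conjTranspose, ← Matrix.star_eq_conjTranspose, ← map_star, ← map_mul,
    trace_act]

end ProjectiveRep

end Action

section Average

/-- The measure with the nonnegative real density `κ` with respect to `μ`. -/
def densityMeasure {Ω : Type*} [MeasurableSpace Ω] (μ : Measure Ω) (κ : Ω → ℝ) : Measure Ω :=
  μ.withDensity fun ω => ENNReal.ofReal (κ ω)

theorem isProbabilityMeasure_densityMeasure {Ω : Type*} [MeasurableSpace Ω] {μ : Measure Ω}
    {κ : Ω → ℝ} (h0 : ∀ ω, 0 ≤ κ ω) (h1 : ∫ ω, κ ω ∂μ = 1) :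
    IsProbabilityMeasure (densityMeasure μ κ) where
  measure_univ := by
    rw [densityMeasure, withDensity_apply _ .univ, setLIntegral_univ,
      ← ofReal_integral_eq_lintegral_ofReal (.of_integral_ne_zero (by simp [h1])) (.of_forall h0),
      h1, ENNReal.ofReal_one]

variable {G : Type*} [Group G] [TopologicalSpace G] [MeasurableSpace G]
variable {n : Type*} [Fintype n] [DecidableEq n]

/-- The mixture `∫ u(g)^* x u(g) dν(g)` of the conjugations by `u(g)`. -/
def average (U : ProjectiveRep G n) (ν : Measure G) (x : Matrix n n ℂ) : Matrix n n ℂ :=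
  ∫ g, U.act g x ∂ν

variable (U : ProjectiveRep G n) {ν : Measure G} {a b x : Matrix n n ℂ}

theorem average_nonneg (hx : 0 ≤ x) : 0 ≤ average U ν x :=
  integral_nonneg fun g => map_nonneg (U.act g) hx

theorem average_eq_self [IsProbabilityMeasure ν] (ha : ∀ᵐ g ∂ν, U.act g a = a) :
    average U ν a = a := by
  rw [average, integral_congr_ae ha, integral_const, probReal_univ, one_smul]

theorem average_densityMeasure {μ : Measure G} {κ : G → ℝ} (hκ : Measurable κ) (h0 : ∀ g, 0 ≤ κ g)
    (x : Matrix n n ℂ) : average U (densityMeasure μ κ) x = ∫ g, κ g • U.act g x ∂μ := by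
  rw [average, densityMeasure, integral_withDensity_eq_integral_toReal_smul hκ.ennreal_ofReal
    (by simp)]
  simp only [ENNReal.toReal_ofReal (h0 _)]

theorem norm_average_le [IsProbabilityMeasure ν] (x : Matrix n n ℂ) : ‖average U ν x‖ ≤ ‖x‖ := by
  refine (norm_integral_le_of_norm_le_const (.of_forall fun g => (U.norm_act g x).le)).trans ?_
  simp

variable [OpensMeasurableSpace G]

theorem integrable_smul_act {c : G → ℝ} (hc : Integrable c ν) (x : Matrix n n ℂ) :
    Integrable (fun g => c g • U.act g x) ν :=
  hc.smul_bdd ‖x‖ (U.continuous_act x).aestronglyMeasurable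
    (.of_forall fun g => (U.norm_act g x).le)

variable [IsFiniteMeasure ν]

theorem integrable_act (x : Matrix n n ℂ) : Integrable (fun g => U.act g x) ν :=
  .of_bound (U.continuous_act x).aestronglyMeasurable ‖x‖ (.of_forall fun g => (U.norm_act g x).le)

theorem average_mono (h : a ≤ b) : average U ν a ≤ average U ν b :=
  integral_mono (integrable_act U a) (integrable_act U b) fun g => OrderHomClass.mono (U.act g) h

theorem map_average {E : Type*} [NormedAddCommGroup E] [NormedSpace ℂ E] [CompleteSpace E]
    (L : Matrix n n ℂ →ₗ[ℂ] E) (x : Matrix n n ℂ) :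
    L (average U ν x) = ∫ g, L (U.act g x) ∂ν :=
  (L.toContinuousLinearMap.integral_comp_comm (integrable_act U x)).symm

theorem average_mul_mul (ha : ∀ᵐ g ∂ν, U.act g a = a) (hb : ∀ᵐ g ∂ν, U.act g b = b)
    (x : Matrix n n ℂ) : average U ν (a * x * b) = a * average U ν x * b := by
  refine Eq.trans (integral_congr_ae ?_) (map_average U (LinearMap.mulLeftRight ℂ (a, b)) x).symm
  filter_upwards [ha, hb] with g hga hgb
  rw [map_mul, map_mul, hga, hgb, LinearMap.mulLeftRight_apply]

theorem trace_average [IsProbabilityMeasure ν] (x : Matrix n n ℂ) :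
    (average U ν x).trace = x.trace := by
  simpa [U.trace_act] using map_average U (ν := ν) (Matrix.traceLinearMap n ℂ ℂ) x

theorem trace_mul_average [IsProbabilityMeasure ν] (ha : ∀ᵐ g ∂ν, U.act g a = a)
    (x : Matrix n n ℂ) : (a * average U ν x).trace = (a * x).trace := by
  have h := average_mul_mul U ha (.of_forall fun g => map_one (U.act g)) x
  rw [← trace_average U (ν := ν) (a * x)]
  simpa using congrArg Matrix.trace h.symm

/-- By strict convexity of the Hilbert–Schmidt norm, a mixture of vectors of the same norm can only
have that norm if it is trivial. -/
theorem ae_act_eq_self_of_average_eq_self [IsProbabilityMeasure ν] (hx : average U ν x = x) :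
    ∀ᵐ g ∂ν, U.act g x = x := by
  have hmean : ∫ g, hsEquiv n (U.act g x) ∂ν = hsEquiv n x := by
    rw [← LinearEquiv.coe_coe, ← map_average, hx]
  rcases ae_eq_const_or_norm_integral_lt_of_norm_le_const (μ := ν)
    (.of_forall fun g => (U.norm_hsEquiv_act g x).le) with h | h
  · filter_upwards [h] with g hg
    rwa [Function.const_apply, average_eq_integral, hmean, EmbeddingLike.apply_eq_iff_eq] at hg
  · rw [hmean, probReal_univ, one_mul] at h
    exact absurd h (lt_irrefl _)

end Average

section FixedPoints

theorem hsProj_eq_of_orthogonal {n : Type*} [Fintype n] (N : Submodule ℂ (Matrix n n ℂ))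
    {x y : Matrix n n ℂ} (hy : y ∈ N) (h : ∀ z ∈ N, (zᴴ * (x - y)).trace = 0) : hsProj N x = y := by
  have hmem : y - hsProj N x ∈ N := N.sub_mem hy (hsProj_mem N x)
  have hzero : ((y - hsProj N x)ᴴ * ((x - hsProj N x) - (x - y))).trace = 0 := by
    rw [Matrix.mul_sub, Matrix.trace_sub, h _ hmem, hsProj_orthogonal N x _ hmem, sub_zero]
  rw [sub_sub_sub_cancel_left] at hzero
  exact (sub_eq_zero.1 (Matrix.trace_conjTranspose_mul_self_eq_zero_iff.1 hzero)).symm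

variable {G : Type*} [Group G] [TopologicalSpace G] {n : Type*} [Fintype n] [DecidableEq n]

/-- The matrices fixed by the conjugations with elements of `H`. -/
def fixedPoints (U : ProjectiveRep G n) (H : Set G) : Submodule ℂ (Matrix n n ℂ) :=
  ⨅ g ∈ H, LinearMap.eqLocus (U.act g) LinearMap.id

/-- The group elements whose conjugations fix every matrix in `N`. -/
def fixer (U : ProjectiveRep G n) (N : Set (Matrix n n ℂ)) : Subgroup G where
  carrier := {g | ∀ x ∈ N, U.act g x = x}
  one_mem' x _ := U.act_one x
  mul_mem' hg hh x hx := by rw [U.act_mul, hg x hx, hh x hx]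
  inv_mem' {g} hg x hx := by
    rw [← hg x hx, ← U.act_mul, mul_inv_cancel, U.act_one, hg x hx]

variable {U : ProjectiveRep G n} {H : Set G} {N : Set (Matrix n n ℂ)}

theorem mem_fixedPoints {x : Matrix n n ℂ} : x ∈ fixedPoints U H ↔ ∀ g ∈ H, U.act g x = x := by
  simp [fixedPoints]

theorem mem_fixer {g : G} : g ∈ fixer U N ↔ ∀ x ∈ N, U.act g x = x := Iff.rfl

theorem isClosed_fixer (U : ProjectiveRep G n) (N : Set (Matrix n n ℂ)) :
    IsClosed (fixer U N : Set G) := by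
  have h : (fixer U N : Set G) = ⋂ x ∈ N, {g | U.act g x = x} := by ext g; simp [mem_fixer]
  rw [h]
  exact isClosed_biInter fun x _ => isClosed_eq (U.continuous_act x) continuous_const

theorem conjTranspose_mem_fixedPoints {x : Matrix n n ℂ} (hx : x ∈ fixedPoints U H) :
    xᴴ ∈ fixedPoints U H :=
  mem_fixedPoints.2 fun g hg => by
    rw [← Matrix.star_eq_conjTranspose, map_star, mem_fixedPoints.1 hx g hg]

theorem cfc_mem_fixedPoints {x : Matrix n n ℂ} (hx0 : x.IsHermitian) (hx : x ∈ fixedPoints U H)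
    (f : ℝ → ℝ) : cfc f x ∈ fixedPoints U H :=
  mem_fixedPoints.2 fun g hg => by
    have h := StarAlgHomClass.map_cfc (U.act g) f x (continuousOn_spectrum x f)
      (StarAlgEquiv.isometry (U.act g)).continuous hx0
      (by rw [mem_fixedPoints.1 hx g hg]; exact hx0)
    rwa [mem_fixedPoints.1 hx g hg] at h

theorem mpow_mem_fixedPoints {x : Matrix n n ℂ} (hx0 : x.IsHermitian) (hx : x ∈ fixedPoints U H)
    (s : ℝ) : mpow x s ∈ fixedPoints U H :=
  cfc_mem_fixedPoints hx0 hx _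

theorem trace_mul_hsProj {a : Matrix n n ℂ} (ha : a ∈ fixedPoints U H)
    (X : Matrix n n ℂ) : (a * hsProj (fixedPoints U H) X).trace = (a * X).trace := by
  have h := hsProj_orthogonal _ X _ (conjTranspose_mem_fixedPoints ha)
  rw [Matrix.conjTranspose_conjTranspose, Matrix.mul_sub, Matrix.trace_sub, sub_eq_zero] at h
  exact h.symm

theorem one_mem_fixedPoints : (1 : Matrix n n ℂ) ∈ fixedPoints U H :=
  mem_fixedPoints.2 fun g _ => map_one (U.act g)

theorem trace_hsProj (X : Matrix n n ℂ) : (hsProj (fixedPoints U H) X).trace = X.trace := by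
  simpa using trace_mul_hsProj (U := U) (H := H) one_mem_fixedPoints X

end FixedPoints

section ConditionalExpectation

variable {G : Type*} [Group G] [TopologicalSpace G] [MeasurableSpace G]
variable {n : Type*} [Fintype n] [DecidableEq n]

theorem measurePreserving_mul_right_cond {G : Type*} [Group G] [MeasurableSpace G]
    [MeasurableMul G] (μ : Measure G) [μ.IsMulRightInvariant]
    {H : Subgroup G} (hH : MeasurableSet (H : Set G)) {h : G} (hh : h ∈ H) :
    MeasurePreserving (· * h) μ[|H] μ[|H] := by
  have hpre : (· * h) ⁻¹' (H : Set G) = H := by ext g; exact H.mul_mem_cancel_right hh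
  have hrestrict := (measurePreserving_mul_right μ h).restrict_preimage hH
  rw [hpre] at hrestrict
  exact hrestrict.smul_measure _

variable {U : ProjectiveRep G n} {μ ν : Measure G} {H : Subgroup G}

theorem average_mem_fixedPoints [MeasurableMul G] [OpensMeasurableSpace G] [IsFiniteMeasure μ]
    [μ.IsMulRightInvariant] (hH : MeasurableSet (H : Set G)) (x : Matrix n n ℂ) :
    average U μ[|H] x ∈ fixedPoints U (H : Set G) :=
  mem_fixedPoints.2 fun h hh => by
    have hmp := measurePreserving_mul_right_cond μ hH hh
    calc U.act h (average U μ[|H] x) = ∫ g, U.act (g * h) x ∂μ[|H] := by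
          simp only [U.act_mul]
          exact map_average U (U.act h : Matrix n n ℂ →ₗ[ℂ] Matrix n n ℂ) x
      _ = average U μ[|H] x := hmp.integral_comp (MeasurableEquiv.mulRight h).measurableEmbedding
          fun g => U.act g x

theorem ae_act_eq_self_of_mem_fixedPoints {H : Set G} (hν : ∀ᵐ g ∂ν, g ∈ H) {x : Matrix n n ℂ}
    (hx : x ∈ fixedPoints U H) : ∀ᵐ g ∂ν, U.act g x = x :=
  hν.mono (mem_fixedPoints.1 hx)

theorem hsProj_fixedPoints [MeasurableMul G] [OpensMeasurableSpace G] [IsFiniteMeasure μ]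
    [μ.IsMulRightInvariant] (hH : MeasurableSet (H : Set G)) (hμH : μ H ≠ 0) (x : Matrix n n ℂ) :
    hsProj (fixedPoints U (H : Set G)) x = average U μ[|H] x := by
  have := ProbabilityTheory.cond_isProbabilityMeasure hμH
  refine hsProj_eq_of_orthogonal _ (average_mem_fixedPoints hH x) fun z hz => ?_
  rw [Matrix.mul_sub, Matrix.trace_sub, sub_eq_zero, trace_mul_average]
  exact ae_act_eq_self_of_mem_fixedPoints (ProbabilityTheory.ae_cond_mem hH)
    (conjTranspose_mem_fixedPoints hz)

theorem hsProj_average [OpensMeasurableSpace G] [IsProbabilityMeasure ν] {H : Set G}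
    (hν : ∀ᵐ g ∂ν, g ∈ H) (x : Matrix n n ℂ) :
    hsProj (fixedPoints U H) (average U ν x) = hsProj (fixedPoints U H) x := by
  refine hsProj_eq_of_orthogonal _ (hsProj_mem _ x) fun z hz => ?_
  rw [Matrix.mul_sub, Matrix.trace_sub, trace_mul_average U
    (ae_act_eq_self_of_mem_fixedPoints hν (conjTranspose_mem_fixedPoints hz)),
    ← Matrix.trace_sub, ← Matrix.mul_sub]
  exact hsProj_orthogonal _ x z hz

end ConditionalExpectation

section EntropyDerivative

theorem hasDerivAt_rpow_exponent {x : ℝ} (hx : 0 ≤ x) {p : ℝ} (hp : 0 < p) :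
    HasDerivAt (fun s : ℝ => x ^ s) (x ^ p * Real.log x) p := by
  rcases hx.eq_or_lt with rfl | hx
  · have hzero : (fun s : ℝ => (0 : ℝ) ^ s) =ᶠ[𝓝 p] fun _ => 0 :=
      (eventually_gt_nhds hp).mono fun s hs => Real.zero_rpow hs.ne'
    simpa using (hasDerivAt_const p (0 : ℝ)).congr_of_eventuallyEq hzero
  · exact (Real.hasStrictDerivAt_const_rpow hx p).hasDerivAt

theorem le_of_hasDerivAt_of_le_right {f g : ℝ → ℝ} {f' g' a : ℝ} (hf : HasDerivAt f f' a)
    (hg : HasDerivAt g g' a) (ha : f a = g a) (hle : ∀ p, a < p → f p ≤ g p) : f' ≤ g' := by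
  have hslope {φ : ℝ → ℝ} {φ' : ℝ} (hφ : HasDerivAt φ φ' a) :
      Tendsto (slope φ a) (𝓝[>] a) (𝓝 φ') :=
    (hasDerivWithinAt_iff_tendsto_slope' Set.self_notMem_Ioi).1 hφ.hasDerivWithinAt
  refine le_of_tendsto_of_tendsto (hslope hf) (hslope hg) ?_
  filter_upwards [self_mem_nhdsWithin] with p (hp : a < p)
  rw [slope_def_field, slope_def_field, ha]
  exact div_le_div_of_nonneg_right (sub_le_sub_right (hle p hp) _) (sub_nonneg.2 hp.le)

theorem rpow_mul_abs_log_le {x M p : ℝ} (hx : 0 ≤ x) (hxM : x ≤ M) (hM : 1 ≤ M)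
    (hp : 1 / 2 ≤ p) (hp' : p ≤ 2) : x ^ p * |Real.log x| ≤ 2 + M ^ 2 * M := by
  have hM0 : 0 ≤ M ^ 2 * M := by positivity
  rcases hx.eq_or_lt with rfl | hx0
  · simpa using by linarith
  rcases le_total x 1 with h1 | h1
  · have hhalf := Real.abs_log_mul_self_rpow_lt x (1 / 2) hx0 h1 (by norm_num)
    rw [abs_mul, abs_of_nonneg (Real.rpow_nonneg hx (1 / 2)), mul_comm, one_div_one_div] at hhalf
    calc x ^ p * |Real.log x| ≤ x ^ (1 / 2 : ℝ) * |Real.log x| := by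
          gcongr ?_ * _
          exact Real.rpow_le_rpow_of_exponent_ge hx0 h1 hp
      _ ≤ 2 + M ^ 2 * M := by linarith
  · have hpow : x ^ p ≤ M ^ 2 :=
      (Real.rpow_le_rpow_of_exponent_le h1 hp').trans (by rw [Real.rpow_two]; gcongr)
    have hlog : |Real.log x| ≤ M := by
      rw [abs_of_nonneg (Real.log_nonneg h1)]
      linarith [Real.log_le_sub_one_of_pos hx0]
    linarith [mul_le_mul hpow hlog (abs_nonneg _) (by positivity)]

theorem hasDerivAt_trace_mpow {n : Type*} [Fintype n] [DecidableEq n] {A : Matrix n n ℂ}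
    (hA : 0 ≤ A) : HasDerivAt (fun p => (mpow A p).trace.re) (A * mlog A).trace.re 1 := by
  have hA' := Matrix.nonneg_iff_posSemidef.1 hA
  have hmul : A * mlog A = cfc (fun x => x * Real.log x) A := by
    rw [cfc_mul _ _ A (continuousOn_spectrum A _) (continuousOn_spectrum A _),
      cfc_id' ℝ A hA'.1.isSelfAdjoint, mlog]
  simp only [trace_mpow_re hA'.1]
  rw [hmul, trace_cfc hA'.1, ← Complex.ofReal_sum, Complex.ofReal_re]
  refine HasDerivAt.fun_sum fun i _ => ?_
  simpa using hasDerivAt_rpow_exponent (hA'.eigenvalues_nonneg i) one_pos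

end EntropyDerivative

section BoundedDensity

variable {Ω : Type*} [MeasurableSpace Ω]

/-- `κ` is a probability density with respect to `μ` that is almost everywhere at most `M`. -/
structure IsBoundedDensity (μ : Measure Ω) (κ : Ω → ℝ) (M : ℝ) : Prop where
  measurable : Measurable κ
  nonneg : ∀ ω, 0 ≤ κ ω
  ae_le : ∀ᵐ ω ∂μ, κ ω ≤ M
  integral_eq_one : ∫ ω, κ ω ∂μ = 1

namespace IsBoundedDensity

variable {μ : Measure Ω} {κ : Ω → ℝ} {M : ℝ}

theorem integrable (hκ : IsBoundedDensity μ κ M) : Integrable κ μ :=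
  .of_integral_ne_zero (by simp [hκ.integral_eq_one])

theorem isProbabilityMeasure (hκ : IsBoundedDensity μ κ M) :
    IsProbabilityMeasure (densityMeasure μ κ) :=
  isProbabilityMeasure_densityMeasure hκ.nonneg hκ.integral_eq_one

theorem norm_ae_le (hκ : IsBoundedDensity μ κ M) : ∀ᵐ ω ∂μ, ‖κ ω‖ ≤ M := by
  simpa only [Real.norm_of_nonneg (hκ.nonneg _)] using hκ.ae_le

theorem eLpNorm_top_le (hκ : IsBoundedDensity μ κ M) : eLpNorm κ ∞ μ ≤ ENNReal.ofReal M := by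
  rw [eLpNorm_exponent_top]
  exact eLpNormEssSup_le_of_ae_bound hκ.norm_ae_le

theorem eLpNorm_top_ne_top (hκ : IsBoundedDensity μ κ M) : eLpNorm κ ∞ μ ≠ ∞ :=
  ne_top_of_le_ne_top ENNReal.ofReal_ne_top hκ.eLpNorm_top_le

theorem toReal_eLpNorm_top (hκ : IsBoundedDensity μ κ M) :
    IsBoundedDensity μ κ (eLpNorm κ ∞ μ).toReal where
  measurable := hκ.measurable
  nonneg := hκ.nonneg
  integral_eq_one := hκ.integral_eq_one
  ae_le := by
    have hne := hκ.eLpNorm_top_ne_top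
    rw [eLpNorm_exponent_top] at hne ⊢
    filter_upwards [enorm_ae_le_eLpNormEssSup κ μ] with ω hω
    simpa [Real.norm_of_nonneg (hκ.nonneg ω)] using ENNReal.toReal_mono hne hω

variable [IsProbabilityMeasure μ]

theorem one_le (hκ : IsBoundedDensity μ κ M) : 1 ≤ M := by
  simpa [hκ.integral_eq_one] using integral_mono_ae hκ.integrable (integrable_const M) hκ.ae_le

theorem integrable_rpow (hκ : IsBoundedDensity μ κ M) {p : ℝ} (hp : 0 ≤ p) :
    Integrable (fun ω => κ ω ^ p) μ := by
  refine .of_bound (hκ.measurable.pow_const p).aestronglyMeasurable (M ^ p) ?_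
  filter_upwards [hκ.ae_le] with ω hω
  rw [Real.norm_of_nonneg (Real.rpow_nonneg (hκ.nonneg ω) p)]
  exact Real.rpow_le_rpow (hκ.nonneg ω) hω hp

theorem tendsto_integral_min_add_rpow (hκ : IsBoundedDensity μ κ M) {p : ℝ} (hp : 0 ≤ p) :
    Tendsto (fun δ => ∫ ω, (min (κ ω) M + δ) ^ p ∂μ) (𝓝[>] 0) (𝓝 (∫ ω, κ ω ^ p ∂μ)) := by
  refine tendsto_integral_filter_of_dominated_convergence (fun _ => (M + 1) ^ p)
    (.of_forall fun δ =>
      (((hκ.measurable.min measurable_const).add_const δ).pow_const p).aestronglyMeasurable) ?_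
    (integrable_const _) ?_
  · filter_upwards [self_mem_nhdsWithin, nhdsWithin_le_nhds (Iic_mem_nhds one_pos)]
      with δ (h0 : 0 < δ) (h1 : δ ≤ 1)
    refine .of_forall fun ω => ?_
    have hmin : 0 ≤ min (κ ω) M + δ :=
      add_nonneg (le_min (hκ.nonneg ω) (zero_le_one.trans hκ.one_le)) h0.le
    rw [Real.norm_of_nonneg (Real.rpow_nonneg hmin p)]
    exact Real.rpow_le_rpow hmin (add_le_add (min_le_right _ _) h1) hp
  · filter_upwards [hκ.ae_le] with ω hω
    have h : Tendsto (fun δ => min (κ ω) M + δ) (𝓝[>] 0) (𝓝 (κ ω)) := by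
      simpa [min_eq_left hω] using
        (tendsto_id.mono_left nhdsWithin_le_nhds : Tendsto id (𝓝[>] (0 : ℝ)) _).const_add (κ ω)
    exact h.rpow_const (.inr hp)

theorem hasDerivAt_integral_rpow (hκ : IsBoundedDensity μ κ M) :
    Integrable (fun ω => κ ω * Real.log (κ ω)) μ ∧
      HasDerivAt (fun p : ℝ => ∫ ω, κ ω ^ p ∂μ) (∫ ω, κ ω * Real.log (κ ω) ∂μ) 1 := by
  have h := hasDerivAt_integral_of_dominated_loc_of_deriv_le (μ := μ)
    (F := fun (p : ℝ) ω => κ ω ^ p) (F' := fun (p : ℝ) ω => κ ω ^ p * Real.log (κ ω)) (x₀ := 1)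
    (s := Set.Ioo (1 / 2 : ℝ) 2) (bound := fun _ => 2 + M ^ 2 * M)
    (Ioo_mem_nhds (by norm_num) (by norm_num))
    (.of_forall fun p => (hκ.measurable.pow_const p).aestronglyMeasurable)
    (hκ.integrable_rpow zero_le_one)
    ((hκ.measurable.pow_const (1 : ℝ)).mul hκ.measurable.log).aestronglyMeasurable
    (hκ.ae_le.mono fun ω hω p hp => by
      rw [norm_mul, Real.norm_of_nonneg (Real.rpow_nonneg (hκ.nonneg ω) p)]
      exact rpow_mul_abs_log_le (hκ.nonneg ω) hω hκ.one_le hp.1.le hp.2.le)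
    (integrable_const _)
    (.of_forall fun ω p hp => hasDerivAt_rpow_exponent (hκ.nonneg ω) (by linarith [hp.1]))
  simpa using h

theorem one_le_integral_rpow (hκ : IsBoundedDensity μ κ M) {p : ℝ} (hp : 1 ≤ p) :
    1 ≤ ∫ ω, κ ω ^ p ∂μ := by
  have hbernoulli (ω : Ω) : 1 + p * (κ ω - 1) ≤ κ ω ^ p := by
    simpa using one_add_mul_self_le_rpow_one_add (s := κ ω - 1) (by linarith [hκ.nonneg ω]) hp
  have hcentered : Integrable (fun ω => κ ω - 1) μ := hκ.integrable.sub (integrable_const 1)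
  calc (1 : ℝ) = ∫ ω, (1 + p * (κ ω - 1)) ∂μ := by
        rw [integral_add (integrable_const 1) (hcentered.const_mul p), integral_const_mul,
          integral_sub hκ.integrable (integrable_const 1), hκ.integral_eq_one]
        simp
    _ ≤ ∫ ω, κ ω ^ p ∂μ := integral_mono ((integrable_const 1).add (hcentered.const_mul p))
        (hκ.integrable_rpow (by linarith)) hbernoulli

theorem integral_rpow_le (hκ : IsBoundedDensity μ κ M) {p : ℝ} (hp : 1 < p) :
    ∫ ω, κ ω ^ p ∂μ ≤ M ^ (p - 1) :=
  calc ∫ ω, κ ω ^ p ∂μ ≤ ∫ ω, M ^ (p - 1) * κ ω ∂μ := by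
        refine integral_mono_ae (hκ.integrable_rpow (by linarith)) (hκ.integrable.const_mul _) ?_
        filter_upwards [hκ.ae_le] with ω hω
        rw [← sub_add_cancel p 1, Real.rpow_add_one' (hκ.nonneg ω) (by linarith),
          add_sub_cancel_right]
        exact mul_le_mul_of_nonneg_right (Real.rpow_le_rpow (hκ.nonneg ω) hω (by linarith))
          (hκ.nonneg ω)
    _ = M ^ (p - 1) := by rw [integral_const_mul, hκ.integral_eq_one, mul_one]

theorem integral_mul_log_le (hκ : IsBoundedDensity μ κ M) :
    ∫ ω, κ ω * Real.log (κ ω) ∂μ ≤ Real.log M :=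
  calc ∫ ω, κ ω * Real.log (κ ω) ∂μ ≤ ∫ ω, κ ω * Real.log M ∂μ := by
        refine integral_mono_ae hκ.hasDerivAt_integral_rpow.1 (hκ.integrable.mul_const _) ?_
        filter_upwards [hκ.ae_le] with ω hω
        rcases (hκ.nonneg ω).eq_or_lt with h0 | h0
        · simp [← h0]
        · exact mul_le_mul_of_nonneg_left (Real.log_le_log h0 hω) h0.le
    _ = Real.log M := by rw [integral_mul_const, hκ.integral_eq_one, one_mul]

theorem mul_log_eLpNorm (hκ : IsBoundedDensity μ κ M) {p : ℝ} (hp : 1 < p) :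
    ((p / (p - 1) : ℝ) : EReal) * ENNReal.log (eLpNorm κ (ENNReal.ofReal p) μ) =
      ((1 / (p - 1) * Real.log (∫ ω, κ ω ^ p ∂μ) : ℝ) : EReal) := by
  have hp0 : 0 < p := by linarith
  have hpos : 0 < ∫ ω, κ ω ^ p ∂μ := one_pos.trans_le (hκ.one_le_integral_rpow hp.le)
  have hnorm := (MemLp.of_bound hκ.measurable.aestronglyMeasurable M
    hκ.norm_ae_le).eLpNorm_eq_integral_rpow_norm (ENNReal.ofReal_pos.2 hp0).ne'
    ENNReal.ofReal_ne_top
  simp only [ENNReal.toReal_ofReal hp0.le, Real.norm_of_nonneg (hκ.nonneg _)] at hnorm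
  rw [hnorm, ENNReal.log_ofReal_of_pos (Real.rpow_pos_of_pos hpos _), Real.log_rpow hpos,
    ← EReal.coe_mul]
  congr 1
  field_simp

theorem mul_log_eLpNorm_le (hκ : IsBoundedDensity μ κ M) {p : ℝ} (hp : 1 < p) :
    ((p / (p - 1) : ℝ) : EReal) * ENNReal.log (eLpNorm κ (ENNReal.ofReal p) μ) ≤
      ((Real.log M : ℝ) : EReal) := by
  have hp1 : 0 < p - 1 := by linarith
  have hlog := Real.log_le_log (one_pos.trans_le (hκ.one_le_integral_rpow hp.le))
    (hκ.integral_rpow_le hp)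
  rw [Real.log_rpow (one_pos.trans_le hκ.one_le)] at hlog
  rwa [hκ.mul_log_eLpNorm hp, EReal.coe_le_coe_iff, one_div, inv_mul_le_iff₀ hp1]

theorem log_eLpNorm_top (hκ : IsBoundedDensity μ κ M) :
    ENNReal.log (eLpNorm κ ∞ μ) = ((Real.log (eLpNorm κ ∞ μ).toReal : ℝ) : EReal) := by
  rw [← ENNReal.log_ofReal_of_pos (one_pos.trans_le hκ.toReal_eLpNorm_top.one_le),
    ENNReal.ofReal_toReal hκ.eLpNorm_top_ne_top]

theorem log_eLpNorm_top_le (hκ : IsBoundedDensity μ κ M) :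
    ENNReal.log (eLpNorm κ ∞ μ) ≤ ((Real.log M : ℝ) : EReal) := by
  rw [← ENNReal.log_ofReal_of_pos (one_pos.trans_le hκ.one_le)]
  exact ENNReal.log_le_log hκ.eLpNorm_top_le

end IsBoundedDensity

end BoundedDensity

section Inequalities

variable {G : Type*} [Group G] [TopologicalSpace G] [MeasurableSpace G]
variable {n : Type*} [Fintype n] [DecidableEq n] {U : ProjectiveRep G n} {X : Matrix n n ℂ}

variable {μ : Measure G} {H : Subgroup G} (hH : MeasurableSet (H : Set G))
variable {κ : G → ℝ} {M : ℝ}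

theorem setIntegral_smul_act_mono [OpensMeasurableSpace G] (s : Set G) (hX : 0 ≤ X) {a b : G → ℝ}
    (ha : Integrable a μ) (hb : Integrable b μ) (hab : a ≤ᵐ[μ] b) :
    ∫ g in s, a g • U.act g X ∂μ ≤ ∫ g in s, b g • U.act g X ∂μ :=
  integral_mono_ae (integrable_smul_act U ha.restrict X) (integrable_smul_act U hb.restrict X)
    ((ae_restrict_of_ae hab).mono fun g hg =>
      smul_le_smul_of_nonneg_right hg (map_nonneg (U.act g) hX))

include hH

theorem average_densityMeasure_eq_setIntegral (hκ : IsBoundedDensity μ κ M)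
    (hκH : ∀ᵐ g ∂densityMeasure μ κ, g ∈ H) (X : Matrix n n ℂ) :
    average U (densityMeasure μ κ) X = ∫ g in H, κ g • U.act g X ∂μ := by
  have hν : densityMeasure μ κ = densityMeasure (μ.restrict H) κ :=
    (Measure.restrict_eq_self_of_ae_mem hκH).symm.trans (restrict_withDensity hH _)
  rw [hν, average_densityMeasure U hκ.measurable hκ.nonneg]

variable [OpensMeasurableSpace G]

theorem trace_mul_setIntegral_smul_act {a : Matrix n n ℂ} (ha : a ∈ fixedPoints U (H : Set G))
    {c : G → ℝ} (hc : Integrable c (μ.restrict H)) (X : Matrix n n ℂ) :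
    (a * ∫ g in H, c g • U.act g X ∂μ).trace.re =
      (∫ g in H, c g ∂μ) * (a * hsProj (fixedPoints U (H : Set G)) X).trace.re := by
  have htrace := trace_mul_integral_mul_re (integrable_smul_act U hc X) a 1
  simp only [Matrix.mul_one, Matrix.mul_smul, Matrix.trace_smul, Complex.smul_re] at htrace
  rw [htrace, ← integral_mul_const]
  refine setIntegral_congr_fun hH fun g hg => ?_
  simp only [smul_eq_mul]
  rw [trace_mul_hsProj ha, ← U.trace_act g (a * X), map_mul, mem_fixedPoints.1 ha g hg]

variable [MeasurableMul G] [IsProbabilityMeasure μ] [μ.IsMulRightInvariant] (hμH : μ H ≠ 0)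

include hμH

theorem hsProj_nonneg (hX : 0 ≤ X) : 0 ≤ hsProj (fixedPoints U (H : Set G)) X := by
  rw [hsProj_fixedPoints hH hμH]
  exact average_nonneg U hX

theorem norm_hsProj_le (X : Matrix n n ℂ) : ‖hsProj (fixedPoints U (H : Set G)) X‖ ≤ ‖X‖ := by
  have := ProbabilityTheory.cond_isProbabilityMeasure hμH
  rw [hsProj_fixedPoints hH hμH]
  exact norm_average_le U X

theorem trace_mpow_hsProj_le (hX : 0 ≤ X) {p : ℝ} (hp : 1 < p) :
    (mpow (hsProj (fixedPoints U (H : Set G)) X) p).trace.re ≤ (mpow X p).trace.re := by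
  set E := hsProj (fixedPoints U (H : Set G)) X with hE
  have hE0 : 0 ≤ E := hsProj_nonneg hH hμH hX
  have hmem : mpow E (p - 1) ∈ fixedPoints U (H : Set G) :=
    mpow_mem_fixedPoints (Matrix.nonneg_iff_posSemidef.1 hE0).1 (hsProj_mem _ X) _
  have htrace : (X * mpow E (p - 1)).trace = (mpow E p).trace := by
    rw [Matrix.trace_mul_comm, ← trace_mul_hsProj hmem, ← hE, Matrix.trace_mul_comm,
      self_mul_mpow hE0 (by linarith)]
  have hyoung := trace_mul_mpow_sub_one_le hX hE0 hp
  rw [htrace] at hyoung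
  linarith

theorem trace_mul_mlog_hsProj_le (hX : 0 ≤ X) :
    (hsProj (fixedPoints U (H : Set G)) X * mlog (hsProj (fixedPoints U (H : Set G)) X)).trace.re ≤
      (X * mlog X).trace.re := by
  have hE := hsProj_nonneg (U := U) hH hμH hX
  refine le_of_hasDerivAt_of_le_right (hasDerivAt_trace_mpow hE) (hasDerivAt_trace_mpow hX) ?_
    fun p hp => trace_mpow_hsProj_le hH hμH hX hp
  rw [mpow_one hE, mpow_one hX, trace_hsProj]

theorem average_restrict (X : Matrix n n ℂ) :
    average U (μ.restrict H) X = μ.real H • hsProj (fixedPoints U (H : Set G)) X := by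
  rw [hsProj_fixedPoints hH hμH, average, average, ProbabilityTheory.cond, integral_smul_measure,
    smul_smul, ENNReal.toReal_inv, ← measureReal_def,
    mul_inv_cancel₀ ((measureReal_ne_zero_iff (measure_ne_top μ _)).2 hμH), one_smul]

theorem setIntegral_act_le (hX : 0 ≤ X) :
    ∫ g in H, U.act g X ∂μ ≤ hsProj (fixedPoints U (H : Set G)) X := by
  rw [← average, average_restrict hH hμH]
  exact (smul_le_smul_of_nonneg_right measureReal_le_one (hsProj_nonneg hH hμH hX)).trans_eq
    (one_smul ℝ _)

theorem posDef_setIntegral_smul_act (hX : 0 ≤ X)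
    (hEX : (hsProj (fixedPoints U (H : Set G)) X).PosDef) {c : G → ℝ}
    (hci : Integrable c μ) {δ : ℝ} (hδ : 0 < δ) (hδc : ∀ g, δ ≤ c g) :
    (∫ g in H, c g • U.act g X ∂μ).PosDef := by
  have hpos : 0 < δ * μ.real H := mul_pos hδ (ENNReal.toReal_pos hμH (measure_ne_top μ _))
  have hlower := setIntegral_smul_act_mono (U := U) H hX (integrable_const δ) hci (.of_forall hδc)
  rw [integral_smul, ← average, average_restrict hH hμH, smul_smul] at hlower
  have hsum := (hEX.smul hpos).add_posSemidef (Matrix.le_iff.1 hlower)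
  rwa [add_sub_cancel] at hsum

variable (hκ : IsBoundedDensity μ κ M) (hκH : ∀ᵐ g ∂densityMeasure μ κ, g ∈ H)

include hκ hκH

theorem norm_average_densityMeasure_le (hX : 0 ≤ X) :
    ‖average U (densityMeasure μ κ) X‖ ≤ M * ‖hsProj (fixedPoints U (H : Set G)) X‖ := by
  have hM : 0 ≤ M := zero_le_one.trans hκ.one_le
  have hle : average U (densityMeasure μ κ) X ≤ M • hsProj (fixedPoints U (H : Set G)) X :=
    calc average U (densityMeasure μ κ) X = ∫ g in H, κ g • U.act g X ∂μ :=
          average_densityMeasure_eq_setIntegral hH hκ hκH X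
      _ ≤ ∫ g in H, M • U.act g X ∂μ :=
          setIntegral_smul_act_mono _ hX hκ.integrable (integrable_const M) hκ.ae_le
      _ = M • ∫ g in H, U.act g X ∂μ := integral_smul M _
      _ ≤ M • hsProj (fixedPoints U (H : Set G)) X :=
          smul_le_smul_of_nonneg_left (setIntegral_act_le hH hμH hX) hM
  refine (CStarAlgebra.norm_le_norm_of_nonneg_of_le (average_nonneg U hX) hle).trans_eq ?_
  rw [norm_smul, Real.norm_of_nonneg hM]

theorem trace_mpow_average_densityMeasure_le_of_le (hX : 0 ≤ X)
    (hEX : (hsProj (fixedPoints U (H : Set G)) X).PosDef) {c : G → ℝ} (hcm : Measurable c)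
    {δ N : ℝ} (hδ : 0 < δ) (hc : ∀ g, c g ∈ Set.Icc δ N) (hκc : κ ≤ᵐ[μ] c) {p : ℝ} (hp : 1 < p) :
    (mpow (average U (densityMeasure μ κ) X) p).trace.re ≤
      (∫ g, c g ^ p ∂μ) * (mpow (hsProj (fixedPoints U (H : Set G)) X) p).trace.re := by
  set B := hsProj (fixedPoints U (H : Set G)) X
  have hB0 : 0 ≤ B := Matrix.nonneg_iff_posSemidef.2 hEX.posSemidef
  have hcp0 (g : G) : 0 ≤ c g ^ p := Real.rpow_nonneg (hδ.le.trans (hc g).1) p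
  have hci : Integrable c μ := .of_mem_Icc δ N hcm.aemeasurable (.of_forall hc)
  have hcpi : Integrable (fun g => c g ^ p) μ :=
    .of_mem_Icc 0 (N ^ p) (hcm.pow_const p).aemeasurable (.of_forall fun g =>
      ⟨hcp0 g, Real.rpow_le_rpow (hδ.le.trans (hc g).1) (hc g).2 (by linarith)⟩)
  have hTZ : average U (densityMeasure μ κ) X ≤ ∫ g in H, c g • U.act g X ∂μ := by
    rw [average_densityMeasure_eq_setIntegral hH hκ hκH]
    exact setIntegral_smul_act_mono _ hX hκ.integrable hci hκc
  calc (mpow (average U (densityMeasure μ κ) X) p).trace.re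
      ≤ (mpow (∫ g in H, c g • U.act g X ∂μ) p).trace.re :=
        trace_mpow_mono (average_nonneg U hX) hTZ hp
    _ ≤ (mpow B (p - 1) * ∫ g in H, c g ^ p • U.act g X ∂μ).trace.re :=
        trace_mpow_integral_smul_le (fun g => map_nonneg (U.act g) hX) (integrable_act U X) hcm hδ
          hc hp hEX (setIntegral_act_le hH hμH hX)
          (posDef_setIntegral_smul_act hH hμH hX hEX hci hδ fun g => (hc g).1)
    _ = (∫ g in H, c g ^ p ∂μ) * (mpow B p).trace.re := by
        rw [trace_mul_setIntegral_smul_act hH (mpow_mem_fixedPoints hEX.1 (hsProj_mem _ X) _)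
          hcpi.restrict, Matrix.trace_mul_comm, self_mul_mpow hB0 (by linarith)]
    _ ≤ (∫ g, c g ^ p ∂μ) * (mpow B p).trace.re :=
        mul_le_mul_of_nonneg_right (setIntegral_le_integral hcpi (.of_forall hcp0))
          (trace_re_nonneg (mpow_nonneg hB0 p))

theorem trace_mpow_average_densityMeasure_le (hX : 0 ≤ X) {p : ℝ} (hp : 1 < p) :
    (mpow (average U (densityMeasure μ κ) X) p).trace.re ≤
      (∫ g, κ g ^ p ∂μ) * (mpow (hsProj (fixedPoints U (H : Set G)) X) p).trace.re := by
  have := hκ.isProbabilityMeasure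
  have hp0 : 0 ≤ p := by linarith
  have hE0 := hsProj_nonneg (U := U) hH hμH hX
  have hone : hsProj (fixedPoints U (H : Set G)) 1 = 1 :=
    hsProj_eq_of_orthogonal _ one_mem_fixedPoints (by simp)
  have hE (δ : ℝ) : hsProj (fixedPoints U (H : Set G)) (X + δ • 1) =
      hsProj (fixedPoints U (H : Set G)) X + δ • 1 := by
    rw [map_add, LinearMap.map_smul_of_tower, hone]
  have hbound : ∀ δ > 0, (mpow (average U (densityMeasure μ κ) X) p).trace.re ≤
      (∫ g, (min (κ g) M + δ) ^ p ∂μ) *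
        (mpow (hsProj (fixedPoints U (H : Set G)) X + δ • 1) p).trace.re := by
    intro δ hδ
    have hX' : X ≤ X + δ • 1 := le_add_of_nonneg_right (smul_nonneg hδ.le zero_le_one)
    refine (trace_mpow_mono (average_nonneg U hX) (average_mono U hX') hp).trans ?_
    rw [← hE]
    refine trace_mpow_average_densityMeasure_le_of_le hH hμH hκ hκH (hX.trans hX') ?_
      ((hκ.measurable.min measurable_const).add_const δ) hδ (fun g => ⟨?_, ?_⟩) ?_ hp (N := M + δ)
    · rw [hE]
      exact (Matrix.PosDef.one.smul hδ).posSemidef_add (Matrix.nonneg_iff_posSemidef.1 hE0)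
    · exact le_add_of_nonneg_left (le_min (hκ.nonneg g) (zero_le_one.trans hκ.one_le))
    · exact add_le_add_left (min_le_right _ _) δ
    · filter_upwards [hκ.ae_le] with g hg
      rw [min_eq_left hg]
      exact le_add_of_nonneg_right hδ.le
  exact ge_of_tendsto ((hκ.tendsto_integral_min_add_rpow hp0).mul
    ((tendsto_trace_mpow_add_smul_one hE0 hp0).mono_left nhdsWithin_le_nhds))
    (eventually_mem_nhdsWithin.mono hbound)

theorem trace_mul_mlog_average_densityMeasure_le (hX : 0 ≤ X) (hX1 : X.trace = 1) :
    (average U (densityMeasure μ κ) X * mlog (average U (densityMeasure μ κ) X)).trace.re ≤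
      (hsProj (fixedPoints U (H : Set G)) X *
        mlog (hsProj (fixedPoints U (H : Set G)) X)).trace.re + ∫ g, κ g * Real.log (κ g) ∂μ := by
  have := hκ.isProbabilityMeasure
  have hE := hsProj_nonneg (U := U) hH hμH hX
  have hT : 0 ≤ average U (densityMeasure μ κ) X := average_nonneg U hX
  have h := le_of_hasDerivAt_of_le_right (hasDerivAt_trace_mpow hT)
    (hκ.hasDerivAt_integral_rpow.2.mul (hasDerivAt_trace_mpow hE)) ?_
    fun p hp => trace_mpow_average_densityMeasure_le hH hμH hκ hκH hX hp
  · simp only [Real.rpow_one] at h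
    rw [mpow_one hE, trace_hsProj, hX1, hκ.integral_eq_one, one_mul, Complex.one_re, mul_one] at h
    linarith
  · simp only [Pi.mul_apply, Real.rpow_one]
    rw [mpow_one hE, mpow_one hT, trace_hsProj, trace_average U, hκ.integral_eq_one, one_mul]

end Inequalities

section Kernel

variable {n : Type*} [Fintype n] [DecidableEq n] {σ ρ : Matrix n n ℂ}

/-- The orthogonal projection onto the kernel of the Hermitian matrix `σ`. -/
def kerProj (σ : Matrix n n ℂ) : Matrix n n ℂ := cfc (fun x : ℝ => if x = 0 then 1 else 0) σ

theorem mul_kerProj (hσ : σ.IsHermitian) : σ * kerProj σ = 0 := by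
  nth_rewrite 1 [← cfc_id' ℝ σ hσ.isSelfAdjoint]
  rw [kerProj, ← cfc_mul _ _ σ (continuousOn_spectrum _ _) (continuousOn_spectrum _ _),
    ← cfc_const_zero ℝ σ]
  exact cfc_congr fun x _ => by split_ifs with hx <;> simp [hx]

theorem kerProj_mul_kerProj (σ : Matrix n n ℂ) : kerProj σ * kerProj σ = kerProj σ := by
  rw [kerProj, ← cfc_mul _ _ σ (continuousOn_spectrum _ _) (continuousOn_spectrum _ _)]
  exact cfc_congr fun x _ => by split_ifs <;> simp

theorem cfc_inv_mul_add_kerProj (hσ : σ.IsHermitian) :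
    cfc (fun x : ℝ => x⁻¹) σ * σ + kerProj σ = 1 := by
  have h (x : ℝ) : x⁻¹ * x + (if x = 0 then 1 else 0) = 1 := by
    split_ifs with hx <;> simp [hx]
  nth_rewrite 2 [← cfc_id' ℝ σ hσ.isSelfAdjoint]
  rw [kerProj, ← cfc_mul _ _ σ (continuousOn_spectrum _ _) (continuousOn_spectrum _ _),
    ← cfc_add σ _ _ (continuousOn_spectrum _ _) (continuousOn_spectrum _ _)]
  simp only [h, cfc_const_one ℝ σ hσ.isSelfAdjoint]

theorem kerLE_iff_mul_kerProj_eq_zero (hσ : σ.IsHermitian) : KerLE σ ρ ↔ ρ * kerProj σ = 0 := by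
  constructor
  · intro h
    refine Matrix.toLin'.injective (LinearMap.ext fun v => ?_)
    rw [Matrix.toLin'_apply, ← Matrix.mulVec_mulVec, map_zero, LinearMap.zero_apply]
    exact h _ (by rw [Matrix.mulVec_mulVec, mul_kerProj hσ, Matrix.zero_mulVec])
  · intro h v hv
    have hker : kerProj σ *ᵥ v = v := by
      simpa [Matrix.add_mulVec, ← Matrix.mulVec_mulVec, hv] using
        congrArg (· *ᵥ v) (cfc_inv_mul_add_kerProj hσ)
    rw [← hker, Matrix.mulVec_mulVec, h, Matrix.zero_mulVec]

theorem kerLE_iff_trace_eq_zero (hσ : σ.IsHermitian) (hρ : 0 ≤ ρ) :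
    KerLE σ ρ ↔ (kerProj σ * ρ).trace = 0 := by
  rw [kerLE_iff_mul_kerProj_eq_zero hσ]
  refine ⟨fun h => by rw [Matrix.trace_mul_comm, h, Matrix.trace_zero], fun h => ?_⟩
  obtain ⟨Y, rfl⟩ := CStarAlgebra.nonneg_iff_eq_star_mul_self.1 hρ
  have hQ : (kerProj σ)ᴴ = kerProj σ := cfc_predicate (R := ℝ) (p := IsSelfAdjoint) _ σ
  have hYQ : Y * kerProj σ = 0 := by
    refine Matrix.trace_conjTranspose_mul_self_eq_zero_iff.1 ?_
    calc ((Y * kerProj σ)ᴴ * (Y * kerProj σ)).trace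
        = (kerProj σ * (star Y * Y) * kerProj σ).trace := by
          simp only [Matrix.conjTranspose_mul, hQ, Matrix.star_eq_conjTranspose, Matrix.mul_assoc]
      _ = (kerProj σ * (star Y * Y)).trace := by
          rw [Matrix.trace_mul_comm, ← Matrix.mul_assoc, kerProj_mul_kerProj]
      _ = 0 := h
  rw [Matrix.mul_assoc, hYQ, Matrix.mul_zero]

theorem trace_mpow_eq_zero_iff (hρ : 0 ≤ ρ) {p : ℝ} (hp : p ≠ 0) :
    (mpow ρ p).trace.re = 0 ↔ ρ = 0 := by
  have hρ' := Matrix.nonneg_iff_posSemidef.1 hρ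
  rw [trace_mpow_re hρ'.1, Finset.sum_eq_zero_iff_of_nonneg fun i _ =>
    Real.rpow_nonneg (hρ'.eigenvalues_nonneg i) p, ← hρ'.1.eigenvalues_eq_zero_iff, funext_iff]
  simp [Real.rpow_eq_zero, hρ'.eigenvalues_nonneg, hp]

theorem conjugate_mpow_nonneg (hρ : 0 ≤ ρ) (σ : Matrix n n ℂ) (s : ℝ) :
    0 ≤ mpow σ s * ρ * mpow σ s :=
  (cfc_predicate (R := ℝ) (p := IsSelfAdjoint) _ σ).conjugate_nonneg hρ

end Kernel

section LogBounds

theorem log_le_log_of_eq_zero_imp {a b : ℝ} (ha : 0 ≤ a) (hab : a ≤ b) (h : a = 0 → b = 0) :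
    Real.log a ≤ Real.log b := by
  rcases ha.eq_or_lt with ha | ha
  · rw [← ha, h ha.symm]
  · exact Real.log_le_log ha hab

theorem log_le_log_add_log {a b c : ℝ} (ha : 0 ≤ a) (hab : a ≤ b) (hc : 1 ≤ c) (hb : b ≤ c * a) :
    Real.log b ≤ Real.log a + Real.log c := by
  rcases ha.eq_or_lt with rfl | ha
  · have hb0 : b = 0 := le_antisymm (by simpa using hb) hab
    simp [hb0, Real.log_nonneg hc]
  · rw [← Real.log_mul ha.ne' (by linarith), mul_comm a c]
    exact Real.log_le_log (ha.trans_le hab) hb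

open Classical in
theorem ite_top_le_ite_top {P Q : Prop} {a b : ℝ} (hQP : Q → P)
    (h : Q → a ≤ b) : (if P then (a : EReal) else ⊤) ≤ if Q then (b : EReal) else ⊤ := by
  by_cases hQ : Q
  · rw [if_pos hQ, if_pos (hQP hQ), EReal.coe_le_coe_iff]
    exact h hQ
  · rw [if_neg hQ]
    exact le_top

open Classical in
theorem ite_top_le_ite_top_add {P Q : Prop} {a b c : ℝ} (hQP : Q → P)
    (h : Q → a ≤ b + c) :
    (if P then (a : EReal) else ⊤) ≤ (if Q then (b : EReal) else ⊤) + (c : EReal) := by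
  by_cases hQ : Q
  · rw [if_pos hQ, if_pos (hQP hQ), ← EReal.coe_add, EReal.coe_le_coe_iff]
    exact h hQ
  · rw [if_neg hQ, EReal.top_add_coe]
    exact le_top

end LogBounds

section Divergence

variable {G : Type*} [Group G] [TopologicalSpace G] [MeasurableSpace G] [OpensMeasurableSpace G]
variable [MeasurableMul G] {n : Type*} [Fintype n] [DecidableEq n] {U : ProjectiveRep G n}
variable {μ ν : Measure G} [IsProbabilityMeasure μ] [μ.IsMulRightInvariant] {H : Subgroup G}
variable (hH : MeasurableSet (H : Set G)) (hμH : μ H ≠ 0) {σ ρ X : Matrix n n ℂ}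

include hH hμH

theorem hsProj_mul_mul {a b : Matrix n n ℂ} (ha : a ∈ fixedPoints U (H : Set G))
    (hb : b ∈ fixedPoints U (H : Set G)) (x : Matrix n n ℂ) :
    hsProj (fixedPoints U (H : Set G)) (a * x * b) =
      a * hsProj (fixedPoints U (H : Set G)) x * b := by
  have hmem := ProbabilityTheory.ae_cond_mem (μ := μ) hH
  rw [hsProj_fixedPoints hH hμH, hsProj_fixedPoints hH hμH]
  exact average_mul_mul U (ae_act_eq_self_of_mem_fixedPoints hmem ha)
    (ae_act_eq_self_of_mem_fixedPoints hmem hb) x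

theorem hsProj_eq_zero_iff (hX : 0 ≤ X) : hsProj (fixedPoints U (H : Set G)) X = 0 ↔ X = 0 := by
  rw [← (Matrix.nonneg_iff_posSemidef.1 hX).trace_eq_zero_iff, ← trace_hsProj (U := U) (H := H),
    (Matrix.nonneg_iff_posSemidef.1 (hsProj_nonneg hH hμH hX)).trace_eq_zero_iff]

variable (hσ : σ.IsHermitian) (hσH : σ ∈ fixedPoints U (H : Set G)) (hρ : 0 ≤ ρ)

include hσ hσH hρ

theorem kerLE_hsProj_iff : KerLE σ (hsProj (fixedPoints U (H : Set G)) ρ) ↔ KerLE σ ρ := by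
  have hQ : kerProj σ ∈ fixedPoints U (H : Set G) := cfc_mem_fixedPoints hσ hσH _
  rw [kerLE_iff_trace_eq_zero hσ hρ, kerLE_iff_trace_eq_zero hσ (hsProj_nonneg hH hμH hρ),
    trace_mul_hsProj hQ]

theorem sandwichedRenyi_hsProj_le {p : ℝ} (hp : 1 < p) :
    sandwichedRenyi p (hsProj (fixedPoints U (H : Set G)) ρ) σ ≤ sandwichedRenyi p ρ σ := by
  have ha := mpow_mem_fixedPoints hσ hσH ((1 - p) / (2 * p))
  have hX := conjugate_mpow_nonneg hρ σ ((1 - p) / (2 * p))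
  have hE := hsProj_nonneg (U := U) hH hμH hX
  have hp0 : p ≠ 0 := by linarith
  have hp1 : 0 ≤ 1 / (p - 1) := one_div_nonneg.2 (by linarith)
  refine ite_top_le_ite_top (kerLE_hsProj_iff hH hμH hσ hσH hρ).2 fun _ => ?_
  rw [← hsProj_mul_mul hH hμH ha ha]
  refine mul_le_mul_of_nonneg_left (log_le_log_of_eq_zero_imp
    (trace_re_nonneg (mpow_nonneg hE p)) (trace_mpow_hsProj_le hH hμH hX hp) ?_) hp1
  rw [trace_mpow_eq_zero_iff hE hp0, trace_mpow_eq_zero_iff hX hp0, hsProj_eq_zero_iff hH hμH hX]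
  exact id

theorem relEntropy_hsProj_le :
    relEntropy (hsProj (fixedPoints U (H : Set G)) ρ) σ ≤ relEntropy ρ σ := by
  have hlog : mlog σ ∈ fixedPoints U (H : Set G) := cfc_mem_fixedPoints hσ hσH _
  refine ite_top_le_ite_top (kerLE_hsProj_iff hH hμH hσ hσH hρ).2 fun _ => ?_
  simp only [Matrix.mul_sub, Matrix.trace_sub, Complex.sub_re, Matrix.trace_mul_comm _ (mlog σ),
    trace_mul_hsProj hlog]
  exact sub_le_sub_right (trace_mul_mlog_hsProj_le hH hμH hρ) _

theorem maxRenyi_hsProj_le :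
    maxRenyi (hsProj (fixedPoints U (H : Set G)) ρ) σ ≤ maxRenyi ρ σ := by
  have ha := mpow_mem_fixedPoints hσ hσH (-(1 / 2))
  refine ite_top_le_ite_top (kerLE_hsProj_iff hH hμH hσ hσH hρ).2 fun _ => ?_
  rw [← hsProj_mul_mul hH hμH ha ha]
  refine log_le_log_of_eq_zero_imp (norm_nonneg _) (norm_hsProj_le hH hμH _) ?_
  rw [norm_eq_zero, norm_eq_zero, hsProj_eq_zero_iff hH hμH (conjugate_mpow_nonneg hρ σ _)]
  exact id

theorem kerLE_average_iff [IsProbabilityMeasure ν] (hν : ∀ᵐ g ∂ν, g ∈ H) :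
    KerLE σ (average U ν ρ) ↔ KerLE σ (hsProj (fixedPoints U (H : Set G)) ρ) := by
  rw [← hsProj_average (U := U) hν, kerLE_hsProj_iff hH hμH hσ hσH (average_nonneg U hρ)]

variable {κ : G → ℝ} {M : ℝ} (hκ : IsBoundedDensity μ κ M)
variable (hκH : ∀ᵐ g ∂densityMeasure μ κ, g ∈ H)

include hκ hκH

theorem sandwichedRenyi_average_le {p : ℝ} (hp : 1 < p) :
    sandwichedRenyi p (average U (densityMeasure μ κ) ρ) σ ≤
      sandwichedRenyi p (hsProj (fixedPoints U (H : Set G)) ρ) σ +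
        ((1 / (p - 1) * Real.log (∫ g, κ g ^ p ∂μ) : ℝ) : EReal) := by
  have := hκ.isProbabilityMeasure
  have ha := mpow_mem_fixedPoints hσ hσH ((1 - p) / (2 * p))
  have haκ := ae_act_eq_self_of_mem_fixedPoints hκH ha
  have hX := conjugate_mpow_nonneg hρ σ ((1 - p) / (2 * p))
  have hp1 : 0 ≤ 1 / (p - 1) := one_div_nonneg.2 (by linarith)
  have hmono := trace_mpow_hsProj_le (U := U) hH hμH
    (average_nonneg U (ν := densityMeasure μ κ) hX) hp
  rw [hsProj_average hκH] at hmono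
  refine ite_top_le_ite_top_add (kerLE_average_iff hH hμH hσ hσH hρ hκH).2 fun _ => ?_
  rw [← hsProj_mul_mul hH hμH ha ha, ← average_mul_mul U haκ haκ, ← mul_add]
  exact mul_le_mul_of_nonneg_left (log_le_log_add_log
    (trace_re_nonneg (mpow_nonneg (hsProj_nonneg hH hμH hX) p)) hmono
    (hκ.one_le_integral_rpow hp.le)
    (trace_mpow_average_densityMeasure_le hH hμH hκ hκH hX hp)) hp1

theorem relEntropy_average_le (hρ1 : ρ.trace = 1) :
    relEntropy (average U (densityMeasure μ κ) ρ) σ ≤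
      relEntropy (hsProj (fixedPoints U (H : Set G)) ρ) σ +
        ((∫ g, κ g * Real.log (κ g) ∂μ : ℝ) : EReal) := by
  have := hκ.isProbabilityMeasure
  have hlog : mlog σ ∈ fixedPoints U (H : Set G) := cfc_mem_fixedPoints hσ hσH _
  have hbound := trace_mul_mlog_average_densityMeasure_le (U := U) hH hμH hκ hκH hρ hρ1
  refine ite_top_le_ite_top_add (kerLE_average_iff hH hμH hσ hσH hρ hκH).2 fun _ => ?_
  simp only [Matrix.mul_sub, Matrix.trace_sub, Complex.sub_re, Matrix.trace_mul_comm _ (mlog σ),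
    trace_mul_hsProj hlog,
    trace_mul_average U (ae_act_eq_self_of_mem_fixedPoints hκH hlog)]
  linarith

theorem maxRenyi_average_le :
    maxRenyi (average U (densityMeasure μ κ) ρ) σ ≤
      maxRenyi (hsProj (fixedPoints U (H : Set G)) ρ) σ + ((Real.log M : ℝ) : EReal) := by
  have := hκ.isProbabilityMeasure
  have ha := mpow_mem_fixedPoints hσ hσH (-(1 / 2))
  have haκ := ae_act_eq_self_of_mem_fixedPoints hκH ha
  have hmono := norm_hsProj_le (U := U) hH hμH
    (average U (densityMeasure μ κ) (mpow σ (-(1 / 2)) * ρ * mpow σ (-(1 / 2))))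
  rw [hsProj_average hκH] at hmono
  refine ite_top_le_ite_top_add (kerLE_average_iff hH hμH hσ hσH hρ hκH).2 fun _ => ?_
  rw [← hsProj_mul_mul hH hμH ha ha, ← average_mul_mul U haκ haκ]
  exact log_le_log_add_log (norm_nonneg _) hmono hκ.one_le
    (norm_average_densityMeasure_le hH hμH hκ hκH (conjugate_mpow_nonneg hρ σ _))

end Divergence

section Domination

theorem densityMeasure_le_smul_iff {Ω : Type*} [MeasurableSpace Ω] {μ : Measure Ω} [SigmaFinite μ]
    {κ : Ω → ℝ} {M : ℝ} (hκ : Measurable κ) (hM : 0 ≤ M) :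
    densityMeasure μ κ ≤ ENNReal.ofReal M • μ ↔ ∀ᵐ ω ∂μ, κ ω ≤ M := by
  have hκM (ω : Ω) : ENNReal.ofReal (κ ω) ≤ ENNReal.ofReal M ↔ κ ω ≤ M :=
    ENNReal.ofReal_le_ofReal_iff hM
  simp only [← hκM, densityMeasure, ← withDensity_const]
  refine ⟨fun h => ae_le_of_forall_setLIntegral_le_of_sigmaFinite hκ.ennreal_ofReal
    fun s hs _ => ?_, withDensity_mono⟩
  simpa only [withDensity_apply _ hs] using h s

theorem isBoundedDensity_of_densityMeasure_le_smul {Ω : Type*} [MeasurableSpace Ω] {μ : Measure Ω}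
    [SigmaFinite μ] {κ : Ω → ℝ} {M : ℝ} (hκ : Measurable κ) (h0 : ∀ ω, 0 ≤ κ ω) (hM : 0 ≤ M)
    [IsProbabilityMeasure (densityMeasure μ κ)] (h : densityMeasure μ κ ≤ ENNReal.ofReal M • μ) :
    IsBoundedDensity μ κ M where
  measurable := hκ
  nonneg := h0
  ae_le := (densityMeasure_le_smul_iff hκ hM).1 h
  integral_eq_one := by
    rw [integral_eq_lintegral_of_nonneg_ae (.of_forall h0) hκ.aestronglyMeasurable,
      ← setLIntegral_univ, ← withDensity_apply _ .univ, ← densityMeasure, measure_univ,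
      ENNReal.toReal_one]

theorem le_of_tendsto_of_frequently_le {X ι : Type*} [TopologicalSpace X] [MeasurableSpace X]
    [OpensMeasurableSpace X] [HasOuterApproxClosed X] {l : Filter ι} {νs : ι → ProbabilityMeasure X}
    {ν : ProbabilityMeasure X} (hν : Tendsto νs l (𝓝 ν)) {m : Measure X} [m.OuterRegular]
    (hle : ∃ᶠ i in l, (νs i : Measure X) ≤ m) : (ν : Measure X) ≤ m := by
  have hopen (O : Set X) (hO : IsOpen O) : (ν : Measure X) O ≤ m O :=
    (ProbabilityMeasure.le_liminf_measure_open_of_tendsto hν hO).trans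
      (liminf_le_of_frequently_le' (hle.mono fun i hi => hi O))
  refine Measure.le_iff'.2 fun s => ?_
  rw [s.measure_eq_iInf_isOpen m]
  exact le_iInf₂ fun O hsO => le_iInf fun hO => (measure_mono hsO).trans (hopen O hO)

theorem finite_of_measure_singleton_one_ne_zero {G : Type*} [Group G] [TopologicalSpace G]
    [IsTopologicalGroup G] [CompactSpace G] [T1Space G] [MeasurableSpace G] [BorelSpace G]
    {μ : Measure G} [μ.IsHaarMeasure] (h : μ {1} ≠ 0) : Finite G := by
  have hopen : IsOpen {(1 : G)} := by
    rw [isOpen_singleton_iff_punctured_nhds, ← not_neBot]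
    exact fun _ => h (measure_singleton 1)
  have := discreteTopology_of_isOpen_singleton_one hopen
  exact finite_of_compact_of_discrete

end Domination

section Haar

variable {G : Type*} [Group G] [TopologicalSpace G] [IsTopologicalGroup G] [CompactSpace G]
variable [MeasurableSpace G] [BorelSpace G]
variable {μ : Measure G} [μ.IsHaarMeasure] [IsProbabilityMeasure μ]

theorem isMulRightInvariant_of_compact : μ.IsMulRightInvariant := by
  refine ⟨fun g => ?_⟩
  have : IsProbabilityMeasure (μ.map (· * g)) :=
    Measure.isProbabilityMeasure_map (measurable_mul_const g).aemeasurable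
  exact Measure.isHaarMeasure_eq_of_isProbabilityMeasure _ μ

theorem isInvInvariant_of_compact [SecondCountableTopology G] : μ.IsInvInvariant := by
  have : μ.IsMulRightInvariant := isMulRightInvariant_of_compact
  have : IsProbabilityMeasure μ.inv := Measure.isProbabilityMeasure_map measurable_inv.aemeasurable
  have : μ.inv.IsHaarMeasure :=
    Measure.isHaarMeasure_of_isCompact_nonempty_interior _ Set.univ isCompact_univ (by simp)
      (by simp) (by simp)
  exact ⟨Measure.isHaarMeasure_eq_of_isProbabilityMeasure _ μ⟩

end Haar

theorem IsBoundedDensity.comp_inv {G : Type*} [Group G] [MeasurableSpace G] [MeasurableInv G]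
    {μ : Measure G} [μ.IsInvInvariant] {κ : G → ℝ} {M : ℝ} (hκ : IsBoundedDensity μ κ M) :
    IsBoundedDensity μ (fun g => κ g⁻¹) M where
  measurable := hκ.measurable.comp measurable_inv
  nonneg g := hκ.nonneg g⁻¹
  ae_le := (Measure.measurePreserving_inv μ).quasiMeasurePreserving.ae hκ.ae_le
  integral_eq_one := (integral_inv_eq_self κ μ).trans hκ.integral_eq_one

section Law

variable {G : Type*} [Group G] [TopologicalSpace G] [MeasurableSpace G] {μ : Measure G}

/-- The distribution at time `t` of the Markov process with semigroup `S` started at `1`. -/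
def MarkovSemigroup.law (S : MarkovSemigroup μ) (t : ℝ≥0) : Measure G :=
  if t = 0 then Measure.dirac 1 else densityMeasure μ fun g => S.k t g⁻¹

variable (S : MarkovSemigroup μ) {t : ℝ≥0}

theorem law_zero : S.law 0 = Measure.dirac 1 := if_pos rfl

theorem law_of_pos (ht : 0 < t) : S.law t = densityMeasure μ fun g => S.k t g⁻¹ := if_neg ht.ne'

theorem k_inv_of_pos (ht : 0 < t) (g : G) : S.k t g⁻¹ = S.K t 1 g := by
  simpa [MarkovSemigroup.k] using S.right_invariant t ht 1 g g⁻¹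

theorem kernelOp_of_pos (ht : 0 < t) (f : G → ℝ) (g : G) :
    kernelOp μ S.K t f g = ∫ h, S.K t g h * f h ∂μ := if_neg ht.ne'

theorem kernelOp_zero (f : G → ℝ) (g : G) : kernelOp μ S.K 0 f g = f g := if_pos rfl

theorem integrable_K (ht : 0 < t) (g : G) : Integrable (S.K t g) μ :=
  .of_integral_ne_zero (by simp [S.mass t ht g])

theorem abs_kernelOp_le {f : G → ℝ} {C : ℝ} (hC : ∀ g, |f g| ≤ C) (g : G) :
    |kernelOp μ S.K t f g| ≤ C := by
  rcases eq_zero_or_pos t with rfl | ht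
  · simpa only [kernelOp_zero] using hC g
  · have hbound (h : G) : ‖S.K t g h * f h‖ ≤ S.K t g h * C := by
      rw [norm_mul, Real.norm_of_nonneg (S.nonneg t ht g h)]
      exact mul_le_mul_of_nonneg_left (hC h) (S.nonneg t ht g h)
    rw [kernelOp_of_pos S ht]
    refine (norm_integral_le_of_norm_le ((integrable_K S ht g).mul_const C)
      (.of_forall hbound)).trans_eq ?_
    rw [integral_mul_const, S.mass t ht g, one_mul]

theorem measurable_kernelOp [SFinite μ] {f : G → ℝ} (hf : Measurable f) :
    Measurable (kernelOp μ S.K t f) := by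
  rcases eq_zero_or_pos t with rfl | ht
  · simpa only [funext (kernelOp_zero S f)] using hf
  · rw [funext (kernelOp_of_pos S ht f)]
    exact ((S.measurable t ht).mul
      (hf.comp measurable_snd)).stronglyMeasurable.integral_prod_right.measurable

theorem tendsto_kernelOp_add [SFinite μ] [CompactSpace G] [OpensMeasurableSpace G] (t : ℝ≥0)
    {f : G → ℝ} (hf : Continuous f) :
    Tendsto (fun δ => kernelOp μ S.K (t + δ) f 1) (𝓝[>] 0) (𝓝 (kernelOp μ S.K t f 1)) := by
  obtain ⟨C, hC⟩ := isCompact_univ.exists_bound_of_continuousOn hf.continuousOn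
  replace hC (g : G) : |f g| ≤ C := hC g (Set.mem_univ g)
  simp only [S.semigroup t _ f hf.measurable ⟨C, hC⟩]
  rcases eq_zero_or_pos t with rfl | ht
  · simpa only [kernelOp_zero] using S.continuous f hf 1
  · simp only [kernelOp_of_pos S ht]
    refine tendsto_integral_filter_of_dominated_convergence (fun h => S.K t 1 h * C)
      (.of_forall fun δ => ?_) (.of_forall fun δ => .of_forall fun h => ?_)
      ((integrable_K S ht 1).mul_const C)
      (.of_forall fun h => (S.continuous f hf h).const_mul _)
    · exact (integrable_K S ht 1).aestronglyMeasurable.mul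
        (measurable_kernelOp S hf.measurable).aestronglyMeasurable
    · rw [norm_mul, Real.norm_of_nonneg (S.nonneg t ht 1 h)]
      exact mul_le_mul_of_nonneg_left (abs_kernelOp_le S hC h) (S.nonneg t ht 1 h)

theorem continuousWithinAt_kernelOp [SFinite μ] [CompactSpace G] [OpensMeasurableSpace G] (t : ℝ≥0)
    {f : G → ℝ} (hf : Continuous f) :
    ContinuousWithinAt (fun s => kernelOp μ S.K s f 1) (Set.Ici t) t := by
  have hsub : Tendsto (fun s : ℝ≥0 => s - t) (𝓝[>] t) (𝓝[>] 0) := by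
    refine tendsto_nhdsWithin_iff.2 ⟨?_, eventually_mem_nhdsWithin.mono fun s hs =>
      tsub_pos_of_lt (Set.mem_Ioi.1 hs)⟩
    have hcont : Continuous fun s : ℝ≥0 => s - t := continuous_id.sub continuous_const
    simpa using hcont.continuousAt.tendsto.mono_left (nhdsWithin_le_nhds (a := t))
  refine continuousWithinAt_Ioi_iff_Ici.1 (((tendsto_kernelOp_add S t hf).comp hsub).congr'
    (eventually_mem_nhdsWithin.mono fun s hs => ?_))
  rw [Function.comp_apply, add_tsub_cancel_of_le (Set.mem_Ioi.1 hs).le]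

instance isProbabilityMeasure_law : IsProbabilityMeasure (S.law t) := by
  rcases eq_zero_or_pos t with rfl | ht
  · rw [law_zero]
    infer_instance
  · rw [law_of_pos S ht]
    refine isProbabilityMeasure_densityMeasure (fun g => S.nonneg t ht g⁻¹ 1) ?_
    simp only [k_inv_of_pos S ht, S.mass t ht 1]

theorem k_zero_inv [T1Space G] [OpensMeasurableSpace G] [Finite G] [IsFiniteMeasure μ]
    [μ.IsOpenPosMeasure] (g : G) :
    S.k 0 g⁻¹ = ({1} : Set G).indicator (fun _ => (μ.real {(1 : G)})⁻¹) g := by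
  have hpos : μ.real {(1 : G)} ≠ 0 :=
    (measureReal_ne_zero_iff).2 ((isOpen_discrete {(1 : G)}).measure_ne_zero μ (by simp))
  have hzero := S.zero ‹_› (({1} : Set G).indicator 1) g⁻¹
  simp only [← Set.indicator_mul_right, Pi.one_apply, mul_one,
    integral_indicator (measurableSet_singleton (1 : G)), integral_singleton, smul_eq_mul] at hzero
  rw [MarkovSemigroup.k, ← mul_right_inj' hpos, hzero]
  by_cases hg : g = 1 <;> simp [hg, hpos]

theorem k_inv_nonneg [T1Space G] [OpensMeasurableSpace G] [IsFiniteMeasure μ]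
    [μ.IsOpenPosMeasure] (ht : IsKernelTime G t) (g : G) : 0 ≤ S.k t g⁻¹ := by
  rcases eq_zero_or_pos t with rfl | h0
  · have : Finite G := ht.resolve_left (lt_irrefl _)
    rw [k_zero_inv]
    exact Set.indicator_nonneg (fun _ _ => inv_nonneg.2 measureReal_nonneg) g
  · exact S.nonneg t h0 g⁻¹ 1

theorem law_eq_densityMeasure [T1Space G] [OpensMeasurableSpace G] [IsFiniteMeasure μ]
    [μ.IsOpenPosMeasure] (ht : IsKernelTime G t) :
    S.law t = densityMeasure μ fun g => S.k t g⁻¹ := by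
  rcases eq_zero_or_pos t with rfl | h0
  · have : Finite G := ht.resolve_left (lt_irrefl _)
    have hpos : μ {(1 : G)} ≠ 0 := (isOpen_discrete {(1 : G)}).measure_ne_zero μ (by simp)
    have hdensity (g : G) : ENNReal.ofReal (S.k 0 g⁻¹) =
        ({1} : Set G).indicator (fun _ => (μ {(1 : G)})⁻¹) g := by
      rw [k_zero_inv]
      by_cases hg : g = 1 <;>
        simp [hg, measureReal_def, ENNReal.ofReal_inv_of_pos, ENNReal.toReal_pos hpos]
    rw [law_zero, densityMeasure, funext hdensity,
      withDensity_indicator (measurableSet_singleton 1), withDensity_const,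
      Measure.restrict_singleton, smul_smul, ENNReal.inv_mul_cancel hpos
        (measure_ne_top _ _), one_smul]
  · exact law_of_pos S h0

theorem isKernelTime_of_law_le_smul [IsTopologicalGroup G] [CompactSpace G] [T1Space G]
    [BorelSpace G] [μ.IsHaarMeasure] {c : ℝ≥0∞} (h : S.law t ≤ c • μ) : IsKernelTime G t := by
  refine or_iff_not_imp_left.2 fun ht => finite_of_measure_singleton_one_ne_zero (μ := μ) ?_
  intro hzero
  have hone := h {1}
  simp [nonpos_iff_eq_zero.1 (not_lt.1 ht), law_zero, hzero] at hone

variable [IsTopologicalGroup G] [SecondCountableTopology G] [BorelSpace G]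

theorem measurable_k_inv [T1Space G] (ht : IsKernelTime G t) : Measurable fun g => S.k t g⁻¹ := by
  rcases ht with h0 | _
  · exact ((S.measurable t h0).comp measurable_prodMk_right).comp measurable_inv
  · exact measurable_of_countable _

theorem kernelOp_apply_one [T1Space G] {f : G → ℝ} (hf : Continuous f) :
    kernelOp μ S.K t f 1 = ∫ g, f g ∂(S.law t) := by
  rcases eq_zero_or_pos t with rfl | ht
  · rw [kernelOp_zero, law_zero, integral_dirac' f 1 hf.measurable.stronglyMeasurable]
  · rw [kernelOp_of_pos S ht, law_of_pos S ht, densityMeasure,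
      integral_withDensity_eq_integral_toReal_smul
        (measurable_k_inv S (.inl ht)).ennreal_ofReal (by simp)]
    simp only [k_inv_of_pos S ht, ENNReal.toReal_ofReal (S.nonneg t ht 1 _), smul_eq_mul]

end Law

section Mixing

variable {G : Type*} [Group G] [TopologicalSpace G] [IsTopologicalGroup G] [CompactSpace G]
variable [T2Space G] [SecondCountableTopology G] [MeasurableSpace G] [BorelSpace G]
variable {μ : Measure G} [μ.IsHaarMeasure] (S : MarkovSemigroup μ) {ε : ℝ} {t : ℝ≥0}

theorem tendsto_law (t : ℝ≥0) :
    Tendsto (β := ProbabilityMeasure G) (fun s => ⟨S.law s, inferInstance⟩) (𝓝[≥] t)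
      (𝓝 ⟨S.law t, inferInstance⟩) := by
  refine ProbabilityMeasure.tendsto_iff_forall_integral_tendsto.2 fun f => ?_
  simp only [ProbabilityMeasure.coe_mk, ← kernelOp_apply_one S f.continuous]
  exact continuousWithinAt_kernelOp S t f.continuous

variable [IsProbabilityMeasure μ]

theorem law_le_smul_of_mem_mixingTimes (hε : 0 ≤ ε) (ht : t ∈ S.mixingTimes ε) :
    S.law t ≤ ENNReal.ofReal (1 + ε) • μ := by
  have : μ.IsInvInvariant := isInvInvariant_of_compact
  have hk : ∀ᵐ g ∂μ, S.k t g ≤ 1 + ε := by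
    have hnorm := ht.2
    rw [eLpNorm_exponent_top] at hnorm
    filter_upwards [enorm_ae_le_eLpNormEssSup (fun g => S.k t g - 1) μ] with g hg
    have hg' := hg.trans hnorm
    rw [← ofReal_norm, ENNReal.ofReal_le_ofReal_iff hε, Real.norm_eq_abs] at hg'
    linarith [le_abs_self (S.k t g - 1)]
  rw [law_eq_densityMeasure S ht.1, densityMeasure_le_smul_iff (measurable_k_inv S ht.1)
    (by linarith)]
  exact (Measure.measurePreserving_inv μ).quasiMeasurePreserving.ae hk

theorem law_tEps_le_smul (hε : 0 ≤ ε) (hne : (S.mixingTimes ε).Nonempty) :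
    S.law (S.tEps ε) ≤ ENNReal.ofReal (1 + ε) • μ := by
  have := TopologicalSpace.metrizableSpace_of_t3_secondCountable G
  have := Measure.OuterRegular.smul μ (ENNReal.ofReal_ne_top (r := 1 + ε))
  exact le_of_tendsto_of_frequently_le (tendsto_law S _)
    (((isGLB_csInf hne (OrderBot.bddBelow _)).frequently_mem hne).mono fun s hs =>
      law_le_smul_of_mem_mixingTimes S hε hs)

theorem isBoundedDensity_k_of_law_le_smul {M : ℝ} (hM : 0 ≤ M)
    (h : S.law t ≤ ENNReal.ofReal M • μ) : IsBoundedDensity μ (S.k t) M := by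
  have : μ.IsInvInvariant := isInvInvariant_of_compact
  have ht := isKernelTime_of_law_le_smul S h
  have hprob := isProbabilityMeasure_law S (t := t)
  rw [law_eq_densityMeasure S ht] at h hprob
  simpa only [inv_inv] using (isBoundedDensity_of_densityMeasure_le_smul (measurable_k_inv S ht)
    (k_inv_nonneg S ht) hM h).comp_inv

end Mixing

section Transference

variable {G : Type*} [Group G] [TopologicalSpace G] [IsTopologicalGroup G] [CompactSpace G]
variable [SecondCountableTopology G] [MeasurableSpace G] [BorelSpace G]
variable {μ : Measure G} [μ.IsHaarMeasure] [IsProbabilityMeasure μ]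
variable {n : Type*} [Fintype n] [DecidableEq n]
variable (S : MarkovSemigroup μ) (U : ProjectiveRep G n) {t : ℝ≥0}

theorem transferred_eq_average [T1Space G] (x : Matrix n n ℂ) :
    transferred S U t x = average U (S.law t) x := by
  change transferredFun S U t x = _
  rcases eq_zero_or_pos t with rfl | ht
  · rw [transferredFun, if_pos rfl, law_zero, average,
      integral_dirac' _ _ (U.continuous_act x).stronglyMeasurable, U.act_one]
  · rw [transferredFun, if_neg ht.ne', law_of_pos S ht,
      average_densityMeasure U (measurable_k_inv S (.inl ht)) fun g => S.nonneg t ht g⁻¹ 1]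
    simp only [Complex.coe_smul, U.act_apply]

theorem ae_law_mem_fixer_Nfix [T1Space G] : ∀ᵐ g ∂S.law t, g ∈ fixer U (Nfix S U) := by
  obtain ⟨s, hs⟩ := IsNoetherian.noetherian (Nfix S U)
  have hfix (x : Matrix n n ℂ) (hx : x ∈ s) : ∀ᵐ g ∂S.law t, U.act g x = x := by
    have hxN : x ∈ Nfix S U := hs ▸ Submodule.subset_span hx
    exact ae_act_eq_self_of_average_eq_self U
      (by rw [← transferred_eq_average]; exact hxN t)
  filter_upwards [(Finset.eventually_all s).2 hfix] with g hg
  have hspan : Nfix S U ≤ LinearMap.eqLocus (U.act g) LinearMap.id := hs ▸ Submodule.span_le.2 hg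
  exact fun x hx => hspan hx

theorem measure_fixer_Nfix_ne_zero [T1Space G] :
    μ (fixer U (Nfix S U) : Set G) ≠ 0 := by
  intro hzero
  have hac : S.law 1 ≪ μ := by
    rw [law_of_pos S one_pos]
    exact withDensity_absolutelyContinuous _ _
  have hmem := ae_law_mem_fixer_Nfix S U (t := 1)
  have hnot : ∀ᵐ g ∂S.law 1, g ∉ fixer U (Nfix S U) := measure_eq_zero_iff_ae_notMem.1 (hac hzero)
  obtain ⟨g, hg, hg'⟩ := (hmem.and hnot).exists
  exact hg' hg

theorem Nfix_eq_fixedPoints [T1Space G] :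
    Nfix S U = fixedPoints U (fixer U (Nfix S U) : Set G) := by
  refine le_antisymm (fun x hx => mem_fixedPoints.2 fun g hg =>
    mem_fixer.1 hg x hx) fun x hx t => ?_
  rw [transferred_eq_average]
  exact average_eq_self U (ae_act_eq_self_of_mem_fixedPoints (ae_law_mem_fixer_Nfix S U) hx)

end Transference

section Bounds

variable {G : Type*} [Group G] [TopologicalSpace G] [IsTopologicalGroup G] [CompactSpace G]
variable [T2Space G] [SecondCountableTopology G] [MeasurableSpace G] [BorelSpace G]
variable {μ : Measure G} [μ.IsHaarMeasure] [IsProbabilityMeasure μ]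
variable {n : Type*} [Fintype n] [DecidableEq n]
variable (S : MarkovSemigroup μ) (U : ProjectiveRep G n) {t : ℝ≥0} {ρ σ : Matrix n n ℂ}

theorem Efix_eq_hsProj_fixedPoints :
    Efix S U = hsProj (fixedPoints U (fixer U (Nfix S U) : Set G)) :=
  congrArg hsProj (Nfix_eq_fixedPoints S U)

theorem Efix_transferred (x : Matrix n n ℂ) : Efix S U (transferred S U t x) = Efix S U x := by
  rw [transferred_eq_average, Efix_eq_hsProj_fixedPoints, hsProj_average]
  exact ae_law_mem_fixer_Nfix S U

theorem transferred_nonneg (hρ : 0 ≤ ρ) : 0 ≤ transferred S U t ρ := by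
  rw [transferred_eq_average]
  exact average_nonneg U hρ

section LowerBound

variable (hσ : σ.IsHermitian) (hσN : σ ∈ Nfix S U) (hρ : 0 ≤ ρ)

include hσ hσN hρ

theorem sandwichedRenyi_Efix_le_transferred {p : ℝ} (hp : 1 < p) :
    sandwichedRenyi p (Efix S U ρ) σ ≤ sandwichedRenyi p (transferred S U t ρ) σ := by
  have : μ.IsMulRightInvariant := isMulRightInvariant_of_compact
  rw [← Efix_transferred S U (t := t), Efix_eq_hsProj_fixedPoints]
  exact sandwichedRenyi_hsProj_le (isClosed_fixer U _).measurableSet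
    (measure_fixer_Nfix_ne_zero S U) hσ (Nfix_eq_fixedPoints S U ▸ hσN)
    (transferred_nonneg S U hρ) hp

theorem relEntropy_Efix_le_transferred :
    relEntropy (Efix S U ρ) σ ≤ relEntropy (transferred S U t ρ) σ := by
  have : μ.IsMulRightInvariant := isMulRightInvariant_of_compact
  rw [← Efix_transferred S U (t := t), Efix_eq_hsProj_fixedPoints]
  exact relEntropy_hsProj_le (isClosed_fixer U _).measurableSet (measure_fixer_Nfix_ne_zero S U)
    hσ (Nfix_eq_fixedPoints S U ▸ hσN) (transferred_nonneg S U hρ)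

theorem maxRenyi_Efix_le_transferred :
    maxRenyi (Efix S U ρ) σ ≤ maxRenyi (transferred S U t ρ) σ := by
  have : μ.IsMulRightInvariant := isMulRightInvariant_of_compact
  rw [← Efix_transferred S U (t := t), Efix_eq_hsProj_fixedPoints]
  exact maxRenyi_hsProj_le (isClosed_fixer U _).measurableSet (measure_fixer_Nfix_ne_zero S U)
    hσ (Nfix_eq_fixedPoints S U ▸ hσN) (transferred_nonneg S U hρ)

end LowerBound

section UpperBound

variable {M : ℝ} (ht : IsKernelTime G t) (hk : IsBoundedDensity μ (S.k t) M)
variable (hσ : σ.IsHermitian) (hσN : σ ∈ Nfix S U) (hρ : 0 ≤ ρ)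

include ht hk hσ hσN hρ

theorem sandwichedRenyi_transferred_le {p : ℝ} (hp : 1 < p) :
    sandwichedRenyi p (transferred S U t ρ) σ ≤ sandwichedRenyi p (Efix S U ρ) σ +
      ((p / (p - 1) : ℝ) : EReal) * ENNReal.log (eLpNorm (S.k t) (ENNReal.ofReal p) μ) := by
  have : μ.IsMulRightInvariant := isMulRightInvariant_of_compact
  have : μ.IsInvInvariant := isInvInvariant_of_compact
  have hH := ae_law_mem_fixer_Nfix S U (t := t)
  rw [hk.mul_log_eLpNorm hp, ← integral_inv_eq_self (fun g => S.k t g ^ p) μ,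
    transferred_eq_average, Efix_eq_hsProj_fixedPoints]
  rw [law_eq_densityMeasure S ht] at hH ⊢
  exact sandwichedRenyi_average_le (isClosed_fixer U _).measurableSet
    (measure_fixer_Nfix_ne_zero S U) hσ (Nfix_eq_fixedPoints S U ▸ hσN) hρ hk.comp_inv hH hp

theorem relEntropy_transferred_le (hρ1 : ρ.trace = 1) :
    relEntropy (transferred S U t ρ) σ ≤ relEntropy (Efix S U ρ) σ +
      ((∫ g, S.k t g * Real.log (S.k t g) ∂μ : ℝ) : EReal) := by
  have : μ.IsMulRightInvariant := isMulRightInvariant_of_compact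
  have : μ.IsInvInvariant := isInvInvariant_of_compact
  have hH := ae_law_mem_fixer_Nfix S U (t := t)
  rw [← integral_inv_eq_self (fun g => S.k t g * Real.log (S.k t g)) μ, transferred_eq_average,
    Efix_eq_hsProj_fixedPoints]
  rw [law_eq_densityMeasure S ht] at hH ⊢
  exact relEntropy_average_le (isClosed_fixer U _).measurableSet
    (measure_fixer_Nfix_ne_zero S U) hσ (Nfix_eq_fixedPoints S U ▸ hσN) hρ hk.comp_inv hH hρ1

theorem maxRenyi_transferred_le :
    maxRenyi (transferred S U t ρ) σ ≤
      maxRenyi (Efix S U ρ) σ + ENNReal.log (eLpNorm (S.k t) ∞ μ) := by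
  have : μ.IsMulRightInvariant := isMulRightInvariant_of_compact
  have : μ.IsInvInvariant := isInvInvariant_of_compact
  have hH := ae_law_mem_fixer_Nfix S U (t := t)
  rw [hk.log_eLpNorm_top, transferred_eq_average, Efix_eq_hsProj_fixedPoints]
  rw [law_eq_densityMeasure S ht] at hH ⊢
  exact maxRenyi_average_le (isClosed_fixer U _).measurableSet (measure_fixer_Nfix_ne_zero S U)
    hσ (Nfix_eq_fixedPoints S U ▸ hσN) hρ hk.toReal_eLpNorm_top.comp_inv hH

end UpperBound

end Bounds

end TransferredQMS

end

theorem mainTheorem2 {G : Type*} [Group G] [TopologicalSpace G] [IsTopologicalGroup G]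
    [CompactSpace G] [T2Space G] [SecondCountableTopology G] [MeasurableSpace G] [BorelSpace G]
    (μ : MeasureTheory.Measure G) [μ.IsHaarMeasure] [MeasureTheory.IsProbabilityMeasure μ]
    {n : Type*} [Fintype n] [DecidableEq n]
    (S : TransferredQMS.MarkovSemigroup μ) (U : TransferredQMS.ProjectiveRep G n)
    (σ : Matrix n n ℂ) (hσ : TransferredQMS.IsFixState S U σ)
    (ρ : Matrix n n ℂ) (hρ : TransferredQMS.IsState ρ)
    (ε : ℝ) (hε : 0 < ε) (hfin : (S.mixingTimes ε).Nonempty) :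
    let t : ℝ≥0 := S.tEps ε
    let Eρ := TransferredQMS.Efix S U ρ
    let Tρ := TransferredQMS.transferred S U t ρ
    -- the case `1 < p < ∞`
    (∀ p : ℝ, 1 < p →
      TransferredQMS.sandwichedRenyi p Eρ σ ≤ TransferredQMS.sandwichedRenyi p Tρ σ ∧
      TransferredQMS.sandwichedRenyi p Tρ σ ≤ TransferredQMS.sandwichedRenyi p Eρ σ +
        ((p / (p - 1) : ℝ) : EReal) *
          ENNReal.log (MeasureTheory.eLpNorm (S.k t) (ENNReal.ofReal p) μ) ∧
      TransferredQMS.sandwichedRenyi p Eρ σ +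
        ((p / (p - 1) : ℝ) : EReal) *
          ENNReal.log (MeasureTheory.eLpNorm (S.k t) (ENNReal.ofReal p) μ) ≤
        TransferredQMS.sandwichedRenyi p Eρ σ + ((Real.log (1 + ε) : ℝ) : EReal)) ∧
    -- the case `p = 1`
    (TransferredQMS.relEntropy Eρ σ ≤ TransferredQMS.relEntropy Tρ σ ∧
      MeasureTheory.Integrable (fun g => S.k t g * Real.log (S.k t g)) μ ∧
      TransferredQMS.relEntropy Tρ σ ≤ TransferredQMS.relEntropy Eρ σ +
        ((∫ g, S.k t g * Real.log (S.k t g) ∂μ : ℝ) : EReal) ∧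
      TransferredQMS.relEntropy Eρ σ +
        ((∫ g, S.k t g * Real.log (S.k t g) ∂μ : ℝ) : EReal) ≤
        TransferredQMS.relEntropy Eρ σ + ((Real.log (1 + ε) : ℝ) : EReal)) ∧
    -- the case `p = ∞`
    (TransferredQMS.maxRenyi Eρ σ ≤ TransferredQMS.maxRenyi Tρ σ ∧
      TransferredQMS.maxRenyi Tρ σ ≤ TransferredQMS.maxRenyi Eρ σ +
        ENNReal.log (MeasureTheory.eLpNorm (S.k t) ∞ μ) ∧
      TransferredQMS.maxRenyi Eρ σ + ENNReal.log (MeasureTheory.eLpNorm (S.k t) ∞ μ) ≤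
        TransferredQMS.maxRenyi Eρ σ + ((Real.log (1 + ε) : ℝ) : EReal)) := by
  intro t Eρ Tρ
  have hlaw := TransferredQMS.law_tEps_le_smul S hε.le hfin
  have ht := TransferredQMS.isKernelTime_of_law_le_smul S hlaw
  have hk := TransferredQMS.isBoundedDensity_k_of_law_le_smul S (by linarith) hlaw
  have hσ0 : σ.IsHermitian := hσ.1.1.1
  have hσN : σ ∈ TransferredQMS.Nfix S U := hσ.2 ▸ TransferredQMS.hsProj_mem _ σ
  have hρ0 := Matrix.nonneg_iff_posSemidef.2 hρ.1
  refine ⟨fun p hp => ⟨?_, ?_, ?_⟩, ⟨?_, ?_, ?_, ?_⟩, ?_, ?_, ?_⟩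
  · exact TransferredQMS.sandwichedRenyi_Efix_le_transferred S U hσ0 hσN hρ0 hp
  · exact TransferredQMS.sandwichedRenyi_transferred_le S U ht hk hσ0 hσN hρ0 hp
  · exact add_le_add le_rfl (hk.mul_log_eLpNorm_le hp)
  · exact TransferredQMS.relEntropy_Efix_le_transferred S U hσ0 hσN hρ0
  · exact hk.hasDerivAt_integral_rpow.1
  · exact TransferredQMS.relEntropy_transferred_le S U ht hk hσ0 hσN hρ0 hρ.2
  · exact add_le_add le_rfl (EReal.coe_le_coe_iff.2 hk.integral_mul_log_le)
  · exact TransferredQMS.maxRenyi_Efix_le_transferred S U hσ0 hσN hρ0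
  · exact TransferredQMS.maxRenyi_transferred_le S U ht hk hσ0 hσN hρ0
  · exact add_le_add le_rfl hk.log_eLpNorm_top_le
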